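/- Let $\psi_1(x)=1$, $\psi_{2j}(x)=\sqrt2\cos(2\pi jx)$, $\psi_{2j+1}(x)=\sqrt2\sin(2\pi jx)$ ($j\ge1$) be the Fourier basis of $L^2[0,1]$, and for $g>0$ let $A^{g}[0,1]$ be the set of $f\in L^2[0,1]$ with $\sum_{i\ge1}e^{g i}|\langle f,\psi_i\rangle_2|<\infty$. Let $\gamma_0>\gamma>1/2$ and $\sigma>0$, and let $f_0\in A^{\gamma_0}[0,1]$ be continuous on $[0,1]$ (i.e. $f_0$ is the continuous representative of its class; it is then infinitely differentiable on $[0,1]$). Let $K(x,x')=\sum_{i\ge1}\mu_i\psi_i(x)\psi_i(x')$ on $[0,1]^2$ with $c\,e^{-2\gamma i}\le\mu_i\le C'e^{-2\gamma i}$ for all $i\ge1$ and some constants $c,C'>0$. Let $(X_i,Y_i)_{i=1}^n$ be i.i.d. with $X_i$ uniform on $[0,1]$ and $Y_i=f_0(X_i)+\varepsilon_i$, where $\varepsilon_i\sim N(0,\sigma^2)$ is independent of $X_i$; denote their joint law by $\mathbb P_0^{(n)}$. For a regularization parameter $\lambda=\lambda_n$ let $$\hat f_n(x)=K(x,X)\,[K(X,X)+n\lambda_n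 I_n]^{-1}Y$$ be the posterior mean of the regression function under the Gaussian process prior $\mathrm{GP}(0,\sigma^2(n\lambda_n)^{-1}K)$. Suppose that $\lambda_n\asymp 1/n$ or $\lambda_n\asymp \log n/n$ for $n\ge2$, i.e. the ratio of the two sides is bounded above and away from zero. Then for every integer $k\ge0$ there is a constant $C>0$, not depending on $n$, such that for every $n\ge1$, with $\mathbb P_0^{(n)}$-probability at least $1-n^{-10}$, $\hat f_n$ is $k$ times continuously differentiable on $[0,1]$ and $$\|\hat f_n^{(k)}-f_0^{(k)}\|_2\le C\,\frac{(\log n)^{k+1}}{\sqrt n},$$ where $\|\cdot\|_2$ is the norm of $L^2[0,1]$. -/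

import Mathlib

open MeasureTheory ProbabilityTheory Set

noncomputable section

/-- Two-sided comparison `a ≍ b` on an index set `S`. -/
def Comparable {ι : Type*} (S : Set ι) (a b : ι → ℝ) : Prop :=
  ∃ c C : ℝ, 0 < c ∧ 0 < C ∧ ∀ i ∈ S, c * b i ≤ a i ∧ a i ≤ C * b i

/-- The uniform (Lebesgue) probability measure on `[0,1]`. -/
def uniform01 : Measure ℝ := volume.restrict (Icc (0 : ℝ) 1)

/-- The real Fourier basis of `L²[0,1]`: `ψ₁ = 1`, `ψ_{2j}(x) = √2 cos(2πjx)`,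
`ψ_{2j+1}(x) = √2 sin(2πjx)`. The natural number `i / 2` is the frequency `j`. -/
def realFourier (i : ℕ+) (x : ℝ) : ℝ :=
  if i = 1 then 1
  else if Even (i : ℕ) then √2 * Real.cos (2 * Real.pi * (((i : ℕ) / 2 : ℕ) : ℝ) * x)
  else √2 * Real.sin (2 * Real.pi * (((i : ℕ) / 2 : ℕ) : ℝ) * x)

/-- The `i`-th Fourier coefficient `⟨f, ψ_i⟩₂`. -/
def realFourierCoef (f : ℝ → ℝ) (i : ℕ+) : ℝ :=
  ∫ x, f x * realFourier i x ∂uniform01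

/-- The analytic-type class `A^g[0,1]`. -/
def AnalyticClass (g : ℝ) (f : ℝ → ℝ) : Prop :=
  MemLp f 2 uniform01 ∧
    Summable fun i : ℕ+ => Real.exp (g * (i : ℝ)) * |realFourierCoef f i|

/-- `K` is, on `[0,1]²`, a covariance kernel `∑ μ_i ψ_i(x) ψ_i(y)` whose eigenfunctions are the
Fourier basis and whose eigenvalues satisfy `μ_i ≍ e^{-2gi}`. -/
def IsExpKernel (g : ℝ) (K : ℝ → ℝ → ℝ) : Prop :=
  ∃ μ : ℕ+ → ℝ,
    Comparable univ μ (fun i : ℕ+ => Real.exp (-2 * g * (i : ℝ))) ∧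
    ∀ x ∈ Icc (0 : ℝ) 1, ∀ y ∈ Icc (0 : ℝ) 1,
      HasSum (fun i : ℕ+ => μ i * realFourier i x * realFourier i y) (K x y)

/-- The law of one observation `(X, Y)`, where `Y = f₀(X) + ε` with `X` uniform on `[0,1]` and
`ε ∼ N(0, σ²)` independent of `X`. -/
def observationLaw (f₀ : ℝ → ℝ) (σ : ℝ) : Measure (ℝ × ℝ) :=
  (uniform01.prod (gaussianReal 0 (Real.toNNReal (σ ^ 2)))).map
    fun p => (p.1, f₀ p.1 + p.2)

/-- The law of `n` independent observations. -/
def sampleLaw (f₀ : ℝ → ℝ) (σ : ℝ) (n : ℕ) : Measure (Fin n → ℝ × ℝ) :=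
  Measure.pi fun _ => observationLaw f₀ σ

/-- The posterior mean `x ↦ K(x,X) [K(X,X) + n l I]⁻¹ Y` under the prior `GP(0, σ² (n l)⁻¹ K)`,
for the data `D i = (X_i, Y_i)`. -/
def posteriorMean (K : ℝ → ℝ → ℝ) (l : ℝ) {n : ℕ} (D : Fin n → ℝ × ℝ) (x : ℝ) : ℝ :=
  (fun i => K x (D i).1) ⬝ᵥ
    ((Matrix.of fun i j => K (D i).1 (D j).1) + ((n : ℝ) * l) • (1 : Matrix (Fin n) (Fin n) ℝ))⁻¹.mulVec
      fun i => (D i).2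

/-- The `k`-th derivative of a function on `[0,1]` (one-sided at the endpoints). -/
def deriv01 (k : ℕ) (f : ℝ → ℝ) : ℝ → ℝ := iteratedDerivWithin k f (Icc (0 : ℝ) 1)

end

/-! Write f₀ = ∑ c_m ψ_m and let θ_m be the Fourier coefficients of the posterior mean. The
representer formula turns the linear system into normal equations. For g = θ - c they read (l/μ_m)
g_m + e_m = r_m. Here e is the empirical Gram matrix of the basis applied to g, and r_m = z_m -
(l/μ_m) c_m combines the averaged noise z with the bias. Pairing with g in the norm ∑ g_m² N_m, N_m
= 1 + l/μ_m, gives q² ∑ g_m² N_m ≤ ∑ r_m²/N_m as soon as the left side is q-coercive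
(`energy_bound`).

Coercivity with q independent of n (`exists_coercivity_constant`) has two sources. For large n, the
Gram matrix is close to the identity, with an error governed by W/√n, W = ∑ d_m/N_m, where d_m = 12
log n + 2m. For the finitely many remaining n, l is bounded below, and the Gram form only has to be
nonnegative.

Concentration (`measure_compl_goodEvent_le`) bounds every noise coefficient and every Gram entry at
once. The levels grow with the index through d_m, so a union bound over infinitely many indices
converges, and it costs at most n⁻¹⁰.

Since 1/N_m ≤ 1 and 1/N_m ≲ n e^{-2γm}, only about log n frequencies matter, each with weight O(log
n); so W ≲ log² n. The bias l ∑ c_m²/μ_m is also O(log² n / n), because γ < γ₀ makes the sum finite.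
Hence the energy is O(log² n / n) (`energy_le_of_mem_goodEvent`). Finally m^{2k} ≲ (log n)^{2k} N_m,
so by Parseval k derivatives cost a factor (log n)^{2k} in the squared norm
(`posteriorMean_error_le`). -/

noncomputable section

/-! ### The trigonometric basis, its derivatives and their orthogonality -/

/-- The angular frequency of the `i`-th Fourier basis function. -/
def fourierFreq (i : ℕ+) : ℝ := 2 * Real.pi * (((i : ℕ) / 2 : ℕ) : ℝ)

/-- The amplitude of the `i`-th Fourier basis function. -/
def fourierAmp (i : ℕ+) : ℝ := if i = 1 then 1 else √2

/-- The phase of the `i`-th Fourier basis function. -/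
def fourierPhase (i : ℕ+) : ℝ := if i = 1 ∨ Even (i : ℕ) then 0 else Real.pi / 2

/-- The `k`-th derivative of the `i`-th Fourier basis function. -/
def fourierDeriv (k : ℕ) (i : ℕ+) (x : ℝ) : ℝ :=
  fourierAmp i * fourierFreq i ^ k *
    Real.cos (fourierFreq i * x - fourierPhase i + k * (Real.pi / 2))

lemma fourierFreq_nonneg (i : ℕ+) : 0 ≤ fourierFreq i := by unfold fourierFreq; positivity

lemma fourierFreq_le (i : ℕ+) : fourierFreq i ≤ Real.pi * i := by
  have h : (((i : ℕ) / 2 : ℕ) : ℝ) ≤ (i : ℕ) / 2 := Nat.cast_div_le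
  have := Real.pi_pos
  unfold fourierFreq
  nlinarith

lemma fourierAmp_nonneg (i : ℕ+) : 0 ≤ fourierAmp i := by
  unfold fourierAmp; split_ifs <;> positivity

lemma fourierAmp_le (i : ℕ+) : fourierAmp i ≤ √2 := by
  unfold fourierAmp; split_ifs
  · exact Real.one_le_sqrt.2 (by norm_num)
  · rfl

lemma realFourier_eq_fourierDeriv (i : ℕ+) : realFourier i = fourierDeriv 0 i := by
  ext x
  unfold realFourier fourierDeriv fourierAmp fourierPhase fourierFreq
  by_cases h1 : i = 1
  · subst h1; simp
  · by_cases h2 : Even (i : ℕ)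
    · simp [h1, h2]
    · simp [h1, h2, Real.cos_sub_pi_div_two]

lemma hasDerivAt_fourierDeriv (k : ℕ) (i : ℕ+) (x : ℝ) :
    HasDerivAt (fourierDeriv k i) (fourierDeriv (k + 1) i x) x := by
  have h1 : HasDerivAt (fun x => fourierFreq i * x - fourierPhase i + k * (Real.pi / 2))
      (fourierFreq i) x := by
    simpa using (((hasDerivAt_id x).const_mul (fourierFreq i)).sub_const
      (fourierPhase i)).add_const (k * (Real.pi / 2))
  have h2 := (h1.cos).const_mul (fourierAmp i * fourierFreq i ^ k)
  refine h2.congr_deriv ?_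
  unfold fourierDeriv
  have h3 : fourierFreq i * x - fourierPhase i + (k + 1 : ℕ) * (Real.pi / 2)
    = (fourierFreq i * x - fourierPhase i + k * (Real.pi / 2)) + Real.pi / 2 := by
    push_cast; ring
  rw [h3, Real.cos_add_pi_div_two]
  ring

lemma continuous_fourierDeriv (k : ℕ) (i : ℕ+) : Continuous (fourierDeriv k i) :=
  continuous_iff_continuousAt.2 fun x => (hasDerivAt_fourierDeriv k i x).continuousAt

lemma continuous_realFourier (i : ℕ+) : Continuous (realFourier i) := by
  rw [realFourier_eq_fourierDeriv]; exact continuous_fourierDeriv 0 i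

lemma abs_fourierDeriv_le (k : ℕ) (i : ℕ+) (x : ℝ) :
    |fourierDeriv k i x| ≤ √2 * fourierFreq i ^ k := by
  unfold fourierDeriv
  have h0 := fourierFreq_nonneg i
  have h1 := fourierAmp_nonneg i
  rw [abs_mul, abs_of_nonneg (by positivity)]
  calc _ ≤ fourierAmp i * fourierFreq i ^ k * 1 := by gcongr; exact Real.abs_cos_le_one _
    _ ≤ _ := by rw [mul_one]; gcongr; exact fourierAmp_le i

lemma abs_realFourier_le (i : ℕ+) (x : ℝ) : |realFourier i x| ≤ √2 := by
  simpa [realFourier_eq_fourierDeriv] using abs_fourierDeriv_le 0 i x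

instance : IsProbabilityMeasure uniform01 := ⟨by simp [uniform01]⟩

lemma integral_uniform01 (f : ℝ → ℝ) : ∫ x, f x ∂uniform01 = ∫ x in (0 : ℝ)..1, f x := by
  rw [uniform01, intervalIntegral.integral_of_le zero_le_one, integral_Icc_eq_integral_Ioc]

lemma ae_uniform01_mem : ∀ᵐ x ∂uniform01, x ∈ Icc (0 : ℝ) 1 :=
  ae_restrict_mem measurableSet_Icc

lemma integrable_uniform01_of_continuous {f : ℝ → ℝ} (hf : Continuous f) :
    Integrable f uniform01 :=
  hf.continuousOn.integrableOn_Icc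

lemma integral_cos_two_pi_int_mul_add (p : ℤ) (θ : ℝ) :
    ∫ x in (0 : ℝ)..1, Real.cos (2 * Real.pi * p * x + θ) = if p = 0 then Real.cos θ else 0 := by
  split_ifs with h
  · simp [h]
  · have hp : 2 * Real.pi * (p : ℝ) ≠ 0 := by
      have : (p : ℝ) ≠ 0 := by exact_mod_cast h
      have := Real.pi_pos
      positivity
    rw [intervalIntegral.integral_comp_mul_add (fun x => Real.cos x) hp θ, integral_cos]
    have : Real.sin (2 * Real.pi * p * 1 + θ) = Real.sin (2 * Real.pi * p * 0 + θ) := by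
      have := Real.sin_add_int_mul_two_pi θ p
      rw [mul_zero, zero_add, ← this]; congr 1; ring
    rw [this]; simp

/-- Differentiation shifts all phases by the same kπ/2, so it preserves orthogonality. The
product-to-sum formula leaves a difference and a sum frequency, and only a zero frequency survives
integration. For `i = 1` the convention 0⁰ = 1 gives the right value at k = 0. -/
lemma integral_fourierDeriv_mul (k : ℕ) (i j : ℕ+) :
    ∫ x, fourierDeriv k i x * fourierDeriv k j x ∂uniform01
      = if i = j then fourierFreq i ^ (2 * k) else 0 := by
  rw [integral_uniform01]
  set m : ℕ := (i : ℕ) / 2 with hm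
  set m' : ℕ := (j : ℕ) / 2 with hm'
  have hfi : fourierFreq i = 2 * Real.pi * m := rfl
  have hfj : fourierFreq j = 2 * Real.pi * m' := rfl
  have key : ∀ x, fourierDeriv k i x * fourierDeriv k j x =
      (fourierAmp i * fourierAmp j / 2 * (fourierFreq i ^ k * fourierFreq j ^ k)) *
      (Real.cos (2 * Real.pi * ((m - m' : ℤ) : ℝ) * x + (fourierPhase j - fourierPhase i)) +
       Real.cos (2 * Real.pi * ((m + m' : ℤ) : ℝ) * x +
          (k * Real.pi - fourierPhase j - fourierPhase i))) := by
    intro x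
    have h := Real.two_mul_cos_mul_cos (fourierFreq i * x - fourierPhase i + k * (Real.pi / 2))
      (fourierFreq j * x - fourierPhase j + k * (Real.pi / 2))
    have e1 : 2 * Real.pi * ((m - m' : ℤ) : ℝ) * x + (fourierPhase j - fourierPhase i) =
      (fourierFreq i * x - fourierPhase i + k * (Real.pi / 2)) -
      (fourierFreq j * x - fourierPhase j + k * (Real.pi / 2)) := by
      rw [hfi, hfj]; push_cast; ring
    have e2 : 2 * Real.pi * ((m + m' : ℤ) : ℝ) * x +
          (k * Real.pi - fourierPhase j - fourierPhase i) =
      (fourierFreq i * x - fourierPhase i + k * (Real.pi / 2)) +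
      (fourierFreq j * x - fourierPhase j + k * (Real.pi / 2)) := by
      rw [hfi, hfj]; push_cast; ring
    rw [e1, e2, ← h]; unfold fourierDeriv; ring
  simp_rw [key]
  rw [intervalIntegral.integral_const_mul, intervalIntegral.integral_add
    (by apply Continuous.intervalIntegrable; fun_prop)
    (by apply Continuous.intervalIntegrable; fun_prop),
    integral_cos_two_pi_int_mul_add, integral_cos_two_pi_int_mul_add]
  have hi1 : m = 0 ↔ i = 1 := by
    rw [← PNat.coe_eq_one_iff]; have := i.pos; omega
  have hj1 : m' = 0 ↔ j = 1 := by
    rw [← PNat.coe_eq_one_iff]; have := j.pos; omega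
  have hs2 : √2 * √2 = (2 : ℝ) := Real.mul_self_sqrt (by norm_num)
  by_cases hij : i = j
  · subst hij
    by_cases h1 : i = 1
    · have hz : m = 0 := hi1.2 h1
      have hz' : m' = 0 := hi1.2 h1
      rcases Nat.eq_zero_or_pos k with rfl | hk
      · simp only [hz, hz', h1, fourierAmp, fourierPhase]; norm_num
      · simp [hfi, hz, hz', hk.ne']
    · have hz : m ≠ 0 := fun h => h1 (hi1.1 h)
      have hne : (m + m' : ℤ) ≠ 0 := by omega
      have heq : (m - m' : ℤ) = 0 := by omega
      rw [if_pos heq, if_neg hne, if_pos rfl]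
      simp only [fourierAmp, h1, if_false, hs2, sub_self, Real.cos_zero]
      ring
  · rw [if_neg hij]
    by_cases hmm : m = m'
    · have h1 : i ≠ 1 := fun h => hij (by rw [h, hj1.1 (hmm ▸ hi1.2 h)])
      have h1' : j ≠ 1 := fun h => hij (by rw [h, hi1.1 (hmm ▸ hj1.2 h)])
      have hz : m ≠ 0 := fun h => h1 (hi1.1 h)
      have hne : (m + m' : ℤ) ≠ 0 := by omega
      rw [if_neg hne]
      have hij' : (i : ℕ) ≠ j := fun h => hij (PNat.coe_injective h)
      -- Distinct indices of equal nonzero frequency are a cosine and a sine, a quarter period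
      -- apart.
      have : Real.cos (fourierPhase j - fourierPhase i) = 0 := by
        rcases Nat.even_or_odd (i : ℕ) with he | he <;> rcases Nat.even_or_odd (j : ℕ) with he' | he'
        · exfalso; obtain ⟨a, ha⟩ := he; obtain ⟨b, hb⟩ := he'; omega
        · have := Nat.not_even_iff_odd.2 he'
          simp [fourierPhase, he, this, h1', Real.cos_pi_div_two]
        · have := Nat.not_even_iff_odd.2 he
          simp [fourierPhase, he', this, h1, Real.cos_pi_div_two]
        · exfalso; obtain ⟨a, ha⟩ := he; obtain ⟨b, hb⟩ := he'; omega
      simp [this]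
    · have hne : (m - m' : ℤ) ≠ 0 := by omega
      have hne' : (m + m' : ℤ) ≠ 0 := by omega
      rw [if_neg hne, if_neg hne']; simp

lemma integral_realFourier_mul (i j : ℕ+) :
    ∫ x, realFourier i x * realFourier j x ∂uniform01 = if i = j then 1 else 0 := by
  simp [realFourier_eq_fourierDeriv, integral_fourierDeriv_mul]

/-! ### Parseval and smoothness for rapidly decaying coefficients -/

/-- Parseval's identity for a dominated series of orthogonal functions. -/
lemma integral_tsum_sq_of_orthogonal {Ω ι : Type*} [MeasurableSpace Ω] [Countable ι]
    {P : Measure Ω} [IsProbabilityMeasure P] {h : ι → Ω → ℝ} {M : ι → ℝ}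
    (hm : ∀ i, AEStronglyMeasurable (h i) P) (hM : Summable M) (hb : ∀ i x, |h i x| ≤ M i)
    (ho : ∀ i j, i ≠ j → ∫ x, h i x * h j x ∂P = 0) :
    HasSum (fun i => ∫ x, h i x ^ 2 ∂P) (∫ x, (∑' i, h i x) ^ 2 ∂P) := by
  have hsum : ∀ x, Summable fun i => h i x := fun x =>
    Summable.of_norm_bounded hM fun i => hb i x
  have hM0 : ∀ i, 0 ≤ M i := fun i => by
    obtain ⟨x⟩ : Nonempty Ω := nonempty_of_isProbabilityMeasure P
    exact (abs_nonneg _).trans (hb i x)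
  have hint : ∀ i j, Integrable (fun x => h i x * h j x) P := fun i j => by
    refine Integrable.of_bound ((hm i).mul (hm j)) (M i * M j) (ae_of_all _ fun x => ?_)
    rw [Real.norm_eq_abs, abs_mul]
    exact mul_le_mul (hb i x) (hb j x) (abs_nonneg _) (hM0 i)
  set T := ∑' i, M i with hT
  have hT0 : 0 ≤ T := tsum_nonneg hM0
  have hFb : ∀ x, |∑' i, h i x| ≤ T := fun x =>
    tsum_of_norm_bounded (f := fun i => h i x) hM.hasSum fun i => hb i x
  have hFm : AEStronglyMeasurable (fun x => ∑' i, h i x) P := by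
    have hm' : AEMeasurable (fun x => ∑' i, h i x) P := by
      choose g hg hgh using fun i => (hm i).aemeasurable
      refine ⟨fun x => ∑' i, g i x, Measurable.tsum hg, ?_⟩
      filter_upwards [ae_all_iff.2 hgh] with x hx
      exact tsum_congr hx
    exact hm'.aestronglyMeasurable
  -- One factor is expanded here and orthogonality leaves the diagonal term; the other factor is
  -- expanded afterwards. Domination by `M` justifies both interchanges.
  have inner : ∀ i, ∫ x, h i x * ∑' j, h j x ∂P = ∫ x, h i x ^ 2 ∂P := fun i => by
    have h1 : HasSum (fun j => ∫ x, h i x * h j x ∂P) (∫ x, ∑' j, h i x * h j x ∂P) := by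
      refine hasSum_integral_of_summable_integral_norm (hint i) ?_
      refine Summable.of_nonneg_of_le (fun j => integral_nonneg fun x => norm_nonneg _)
        (fun j => ?_) (hM.mul_left (M i))
      calc ∫ x, ‖h i x * h j x‖ ∂P ≤ ∫ x, M i * M j ∂P := by
            refine integral_mono (hint i j).norm (integrable_const _) fun x => ?_
            simp only [norm_mul, Real.norm_eq_abs]
            exact mul_le_mul (hb i x) (hb j x) (abs_nonneg _) (hM0 i)
        _ = M i * M j := by simp
    have h2 := h1.unique (hasSum_single i fun j hj => ho i j hj.symm)
    simp_rw [tsum_mul_left] at h2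
    rw [h2]
    simp_rw [sq]
  have hint2 : ∀ i, Integrable (fun x => h i x * ∑' j, h j x) P := fun i => by
    refine Integrable.of_bound ((hm i).mul hFm) (M i * T) (ae_of_all _ fun x => ?_)
    rw [Real.norm_eq_abs, abs_mul]
    exact mul_le_mul (hb i x) (hFb x) (abs_nonneg _) (hM0 i)
  have h1 : HasSum (fun i => ∫ x, h i x * ∑' j, h j x ∂P)
      (∫ x, ∑' i, h i x * ∑' j, h j x ∂P) := by
    refine hasSum_integral_of_summable_integral_norm hint2 ?_
    refine Summable.of_nonneg_of_le (fun j => integral_nonneg fun x => norm_nonneg _)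
      (fun i => ?_) (hM.mul_right T)
    calc ∫ x, ‖h i x * ∑' j, h j x‖ ∂P ≤ ∫ x, M i * T ∂P := by
          refine integral_mono (hint2 i).norm (integrable_const _) fun x => ?_
          simp only [norm_mul, Real.norm_eq_abs]
          exact mul_le_mul (hb i x) (hFb x) (abs_nonneg _) (hM0 i)
      _ = M i * T := by simp
  simp_rw [tsum_mul_right, inner] at h1
  simpa [sq] using h1

/-- Coefficient sequences for which the Fourier series is smooth. -/
def RapidDecay (a : ℕ+ → ℝ) : Prop := ∀ k : ℕ, Summable fun i => |a i| * fourierFreq i ^ k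

/-- The function with Fourier coefficients `a`. -/
def fourierSeries (a : ℕ+ → ℝ) (k : ℕ) (x : ℝ) : ℝ := ∑' i, a i * fourierDeriv k i x

namespace RapidDecay

variable {a b : ℕ+ → ℝ}

lemma summable_abs (ha : RapidDecay a) : Summable fun i => |a i| := by simpa using ha 0

lemma summable (ha : RapidDecay a) (k : ℕ) (x : ℝ) :
    Summable fun i => a i * fourierDeriv k i x := by
  refine Summable.of_norm_bounded ((ha k).mul_left (√2)) fun i => ?_
  rw [norm_mul, Real.norm_eq_abs, Real.norm_eq_abs]
  calc _ ≤ |a i| * (√2 * fourierFreq i ^ k) := by gcongr; exact abs_fourierDeriv_le k i x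
    _ = _ := by ring

lemma sub (ha : RapidDecay a) (hb : RapidDecay b) : RapidDecay fun i => a i - b i := fun k => by
  refine Summable.of_nonneg_of_le (fun i => ?_) (fun i => ?_) ((ha k).add (hb k))
  · have := fourierFreq_nonneg i; positivity
  · rw [← add_mul]
    have := fourierFreq_nonneg i
    gcongr; exact abs_sub _ _

lemma hasDerivAt (ha : RapidDecay a) (k : ℕ) (x : ℝ) :
    HasDerivAt (fourierSeries a k) (fourierSeries a (k + 1) x) x := by
  refine hasDerivAt_tsum ((ha (k + 1)).mul_left (√2))
    (fun i y => (hasDerivAt_fourierDeriv k i y).const_mul (a i)) (fun i y => ?_)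
    (ha.summable k 0) x
  rw [norm_mul, Real.norm_eq_abs, Real.norm_eq_abs]
  calc _ ≤ |a i| * (√2 * fourierFreq i ^ (k + 1)) := by
        gcongr; exact abs_fourierDeriv_le (k + 1) i y
    _ = _ := by ring

lemma iteratedDeriv_eq (ha : RapidDecay a) (k : ℕ) :
    iteratedDeriv k (fourierSeries a 0) = fourierSeries a k := by
  induction k with
  | zero => simp
  | succ k ih =>
    rw [iteratedDeriv_succ, ih]
    ext x
    exact (ha.hasDerivAt k x).deriv

lemma contDiff (ha : RapidDecay a) (k : ℕ) : ContDiff ℝ k (fourierSeries a 0) := by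
  refine (contDiff_of_differentiable_iteratedDeriv (n := (k : ℕ∞)) fun m _ => ?_)
  rw [ha.iteratedDeriv_eq]
  exact fun x => (ha.hasDerivAt m x).differentiableAt

lemma continuous (ha : RapidDecay a) (k : ℕ) : Continuous (fourierSeries a k) :=
  continuous_iff_continuousAt.2 fun x => (ha.hasDerivAt k x).continuousAt

/-- The series is smooth on all of ℝ, so the one-sided derivatives at the endpoints are its ordinary
ones. -/
lemma deriv01_eq (ha : RapidDecay a) {f : ℝ → ℝ} (hf : EqOn f (fourierSeries a 0) (Icc 0 1))
    (k : ℕ) : EqOn (deriv01 k f) (fourierSeries a k) (Icc 0 1) := fun x hx => by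
  rw [deriv01, iteratedDerivWithin_congr hf hx, iteratedDerivWithin_eq_iteratedDeriv
    (uniqueDiffOn_Icc zero_lt_one) (ha.contDiff k).contDiffAt hx, ha.iteratedDeriv_eq]

lemma contDiffOn (ha : RapidDecay a) {f : ℝ → ℝ} (hf : EqOn f (fourierSeries a 0) (Icc 0 1))
    (k : ℕ) : ContDiffOn ℝ k f (Icc 0 1) :=
  (ha.contDiff k).contDiffOn.congr hf

lemma fourierSeries_sub (ha : RapidDecay a) (hb : RapidDecay b) (k : ℕ) (x : ℝ) :
    fourierSeries (fun i => a i - b i) k x = fourierSeries a k x - fourierSeries b k x := by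
  unfold fourierSeries
  rw [← (ha.summable k x).tsum_sub (hb.summable k x)]
  simp_rw [sub_mul]

lemma hasSum_sq (ha : RapidDecay a) (k : ℕ) :
    HasSum (fun i => a i ^ 2 * fourierFreq i ^ (2 * k))
      (∫ x, fourierSeries a k x ^ 2 ∂uniform01) := by
  have h := integral_tsum_sq_of_orthogonal (P := uniform01)
    (h := fun i x => a i * fourierDeriv k i x) (M := fun i => √2 * (|a i| * fourierFreq i ^ k))
    (fun i => ((continuous_fourierDeriv k i).const_mul _).aestronglyMeasurable)
    ((ha k).mul_left _) (fun i x => ?_) fun i j hij => ?_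
  · rw [show (∫ x, fourierSeries a k x ^ 2 ∂uniform01) =
      ∫ x, (∑' i, a i * fourierDeriv k i x) ^ 2 ∂uniform01 from rfl]
    convert h using 2 with i
    have h2 := integral_fourierDeriv_mul k i i
    rw [if_pos rfl] at h2
    rw [← h2, ← integral_const_mul]
    congr 1; ext x; ring
  · rw [abs_mul]
    calc _ ≤ |a i| * (√2 * fourierFreq i ^ k) := by gcongr; exact abs_fourierDeriv_le k i x
      _ = _ := by ring
  · have h2 := integral_fourierDeriv_mul k i j
    rw [if_neg hij] at h2
    calc _ = ∫ x, a i * a j * (fourierDeriv k i x * fourierDeriv k j x) ∂uniform01 := by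
          congr 1; ext x; ring
      _ = 0 := by rw [integral_const_mul, h2, mul_zero]

lemma realFourierCoef_fourierSeries (ha : RapidDecay a) (j : ℕ+) :
    realFourierCoef (fourierSeries a 0) j = a j := by
  have h1 : HasSum (fun i => ∫ x, a i * fourierDeriv 0 i x * realFourier j x ∂uniform01)
      (∫ x, ∑' i, a i * fourierDeriv 0 i x * realFourier j x ∂uniform01) := by
    have hc : ∀ i, Continuous fun x => a i * fourierDeriv 0 i x * realFourier j x := fun i =>
      ((continuous_fourierDeriv 0 i).const_mul _).mul (continuous_realFourier j)
    refine hasSum_integral_of_summable_integral_norm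
      (fun i => integrable_uniform01_of_continuous (hc i)) ?_
    refine Summable.of_nonneg_of_le (fun j => integral_nonneg fun x => norm_nonneg _)
      (fun i => ?_) (ha.summable_abs.mul_left (√2 * √2))
    calc _ ≤ ∫ x, √2 * √2 * |a i| ∂uniform01 := by
          refine integral_mono (integrable_uniform01_of_continuous (hc i)).norm
            (integrable_const _) fun x => ?_
          simp only [norm_mul, Real.norm_eq_abs]
          have e1 := abs_realFourier_le j x
          have e2 := abs_realFourier_le i x
          rw [realFourier_eq_fourierDeriv] at e2
          calc _ ≤ |a i| * √2 * √2 := by gcongr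
            _ = _ := by ring
      _ = _ := by simp
  simp_rw [tsum_mul_right, ← realFourier_eq_fourierDeriv, mul_assoc, integral_const_mul,
    integral_realFourier_mul] at h1
  have h2 := h1.unique (hasSum_single j fun i hi => by simp [hi])
  rw [if_pos rfl, mul_one] at h2
  rw [← h2]
  simp [realFourierCoef, fourierSeries, realFourier_eq_fourierDeriv]

end RapidDecay

/-! ### Completeness of the basis and recovery of f₀ from its coefficients -/

/-- A function on `[0,1]` all of whose Fourier coefficients vanish is zero almost everywhere. -/
lemma ae_eq_zero_of_realFourierCoef_eq_zero {G : ℝ → ℝ} (hG : MemLp G 2 uniform01)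
    (h : ∀ i, realFourierCoef G i = 0) : G =ᵐ[uniform01] 0 := by
  have hres : uniform01 = volume.restrict (Ioc (0 : ℝ) 1) :=
    Measure.restrict_congr_set Ioc_ae_eq_Icc.symm
  have hGi : Integrable G uniform01 := hG.integrable (by norm_num)
  have hcos : ∀ m : ℕ, ∫ x, G x * Real.cos (2 * Real.pi * m * x) ∂uniform01 = 0 := fun m => by
    rcases Nat.eq_zero_or_pos m with rfl | hm
    · simpa [realFourierCoef, realFourier] using h 1
    · obtain ⟨i, hi⟩ : ∃ i : ℕ+, (i : ℕ) = 2 * m := ⟨⟨2 * m, by omega⟩, rfl⟩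
      have h1 := h i
      have hne : i ≠ 1 := by rintro rfl; rw [PNat.one_coe] at hi; omega
      simp only [realFourierCoef, realFourier, hne, if_false, hi, even_two_mul, if_true,
        Nat.mul_div_cancel_left m two_pos] at h1
      have h3 : ∫ x, √2 * (G x * Real.cos (2 * Real.pi * m * x)) ∂uniform01 = 0 := by
        rw [← h1]; congr 1; ext x; ring
      rw [integral_const_mul] at h3
      simpa using h3
  have hsin : ∀ m : ℕ, ∫ x, G x * Real.sin (2 * Real.pi * m * x) ∂uniform01 = 0 := fun m => by
    rcases Nat.eq_zero_or_pos m with rfl | hm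
    · simp
    · obtain ⟨i, hi⟩ : ∃ i : ℕ+, (i : ℕ) = 2 * m + 1 := ⟨⟨2 * m + 1, by omega⟩, rfl⟩
      have h1 := h i
      have hne : i ≠ 1 := by rintro rfl; rw [PNat.one_coe] at hi; omega
      have hodd : ¬ Even (2 * m + 1) := by simp
      have hd : (2 * m + 1) / 2 = m := by omega
      simp only [realFourierCoef, realFourier, hne, if_false, hi, hodd, hd] at h1
      have h3 : ∫ x, √2 * (G x * Real.sin (2 * Real.pi * m * x)) ∂uniform01 = 0 := by
        rw [← h1]; congr 1; ext x; ring
      rw [integral_const_mul] at h3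
      simpa using h3
  have hcosZ : ∀ m : ℤ, ∫ x, G x * Real.cos (2 * Real.pi * m * x) ∂uniform01 = 0 := fun m => by
    obtain ⟨p, rfl | rfl⟩ := m.eq_nat_or_neg
    · exact_mod_cast hcos p
    · simpa using hcos p
  have hsinZ : ∀ m : ℤ, ∫ x, G x * Real.sin (2 * Real.pi * m * x) ∂uniform01 = 0 := fun m => by
    obtain ⟨p, rfl | rfl⟩ := m.eq_nat_or_neg
    · exact_mod_cast hsin p
    · simpa [integral_neg] using hsin p
  have hmem : MemLp (fun x => (G x : ℂ)) 2 (volume.restrict (Ioc (0 : ℝ) 1)) := by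
    rw [← hres]; exact hG.ofReal
  -- The complex coefficients are combinations of the cosine and sine integrals, so they vanish;
  -- Parseval for the complex exponentials then forces ∫ G² = 0.
  have hcoef : ∀ m : ℤ, fourierCoeffOn (zero_lt_one : (0 : ℝ) < 1) (fun x => (G x : ℂ)) m = 0 := by
    intro m
    rw [fourierCoeffOn_eq_integral, intervalIntegral.integral_of_le zero_le_one, ← hres]
    have e : ∀ x : ℝ, (fourier (-m) : AddCircle ((1 : ℝ) - 0) → ℂ) (x : AddCircle ((1 : ℝ) - 0))
        • (G x : ℂ) = ((G x * Real.cos (2 * Real.pi * m * x) : ℝ) : ℂ) -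
          Complex.I * ((G x * Real.sin (2 * Real.pi * m * x) : ℝ) : ℂ) := fun x => by
      rw [fourier_coe_apply]
      have : (2 * Real.pi * Complex.I * ((-m : ℤ) : ℂ) * x / ((1 - 0 : ℝ) : ℂ)) =
        ((-(2 * Real.pi * m * x) : ℝ) : ℂ) * Complex.I := by push_cast; ring
      rw [this, Complex.exp_mul_I, ← Complex.ofReal_cos, ← Complex.ofReal_sin, Real.cos_neg,
        Real.sin_neg, smul_eq_mul]
      push_cast; ring
    simp_rw [e]
    have i1 : Integrable (fun x => G x * Real.cos (2 * Real.pi * m * x)) uniform01 :=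
      hGi.mul_bdd (c := 1) (by fun_prop) (ae_of_all _ fun x => Real.abs_cos_le_one _)
    have i2 : Integrable (fun x => G x * Real.sin (2 * Real.pi * m * x)) uniform01 :=
      hGi.mul_bdd (c := 1) (by fun_prop) (ae_of_all _ fun x => Real.abs_sin_le_one _)
    rw [integral_sub i1.ofReal (i2.ofReal.const_mul _), integral_const_mul, integral_complex_ofReal,
      integral_complex_ofReal, hcosZ, hsinZ]
    simp
  have hp := hasSum_sq_fourierCoeffOn zero_lt_one hmem
  simp only [hcoef, norm_zero, ne_eq, OfNat.ofNat_ne_zero, not_false_eq_true, zero_pow, sub_zero,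
    inv_one, one_smul, Complex.norm_real, Real.norm_eq_abs, sq_abs] at hp
  have hz := hp.unique hasSum_zero
  rw [intervalIntegral.integral_of_le zero_le_one, ← hres] at hz
  have := (integral_eq_zero_iff_of_nonneg (fun x => sq_nonneg (G x)) hG.integrable_sq).1 hz
  filter_upwards [this] with x hx
  simpa using hx

/-- A continuous function with rapidly decaying Fourier coefficients is the sum of its Fourier
series. -/
lemma eqOn_fourierSeries {f : ℝ → ℝ} (hf : ContinuousOn f (Icc 0 1)) (hf2 : MemLp f 2 uniform01)
    (hd : RapidDecay (realFourierCoef f)) :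
    EqOn f (fourierSeries (realFourierCoef f) 0) (Icc 0 1) := by
  set F := fourierSeries (realFourierCoef f) 0 with hF
  have hFc : Continuous F := hd.continuous 0
  have hFm : MemLp F 2 uniform01 := by
    obtain ⟨B, hB⟩ := isCompact_Icc.exists_bound_of_continuousOn (hFc.continuousOn (s := Icc 0 1))
    refine MemLp.of_bound hFc.aestronglyMeasurable B ?_
    filter_upwards [ae_uniform01_mem] with x hx using hB x hx
  have hz : (fun x => f x - F x) =ᵐ[uniform01] 0 := by
    refine ae_eq_zero_of_realFourierCoef_eq_zero (hf2.sub hFm) fun i => ?_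
    have h1 := hd.realFourierCoef_fourierSeries i
    have hm : ∀ {g : ℝ → ℝ}, MemLp g 2 uniform01 →
        Integrable (fun x => g x * realFourier i x) uniform01 := fun hg =>
      (hg.integrable (by norm_num)).mul_bdd (c := √2)
        (continuous_realFourier i).aestronglyMeasurable (ae_of_all _ (abs_realFourier_le i))
    rw [realFourierCoef] at h1 ⊢
    simp_rw [sub_mul]
    rw [integral_sub (hm hf2) (hm hFm), h1, realFourierCoef, sub_self]
  have hz' : f =ᵐ[volume.restrict (Icc (0 : ℝ) 1)] F := by
    filter_upwards [hz] with x hx using sub_eq_zero.1 hx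
  exact Measure.eqOn_Icc_of_ae_eq volume zero_ne_one hz' hf hFc.continuousOn

/-! ### Abstract energy and coercivity estimates -/

/-- Weighted Cauchy–Schwarz inequality for series. -/
lemma summable_mul_and_tsum_sq_le {ι : Type*} {x y N : ι → ℝ} (hN : ∀ i, 0 < N i)
    (hx : Summable fun i => x i ^ 2 / N i) (hy : Summable fun i => y i ^ 2 * N i) :
    (Summable fun i => |x i * y i|) ∧
      (∑' i, |x i * y i|) ^ 2 ≤ (∑' i, x i ^ 2 / N i) * ∑' i, y i ^ 2 * N i := by
  have hs : Summable fun i => |x i * y i| := by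
    refine Summable.of_nonneg_of_le (fun i => abs_nonneg _) (fun i => ?_) (hx.add hy)
    have hNi := hN i
    rw [abs_le, div_add' _ _ _ hNi.ne', le_div_iff₀ hNi, neg_le, neg_eq_neg_one_mul,
      ← mul_neg_one, le_div_iff₀ hNi]
    constructor <;> nlinarith [sq_nonneg (x i + y i * N i), sq_nonneg (x i - y i * N i),
      sq_nonneg (x i), sq_nonneg (y i * N i)]
  refine ⟨hs, ?_⟩
  refine le_of_tendsto (hs.hasSum.pow 2) (Filter.Eventually.of_forall fun s => ?_)
  calc (∑ i ∈ s, |x i * y i|) ^ 2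
      = (∑ i ∈ s, (|x i| / √(N i)) * (|y i| * √(N i))) ^ 2 := by
        congr 1
        refine Finset.sum_congr rfl fun i _ => ?_
        have := Real.sqrt_pos.2 (hN i)
        rw [abs_mul]; field_simp
    _ ≤ (∑ i ∈ s, (|x i| / √(N i)) ^ 2) * ∑ i ∈ s, (|y i| * √(N i)) ^ 2 :=
        Finset.sum_mul_sq_le_sq_mul_sq _ _ _
    _ = (∑ i ∈ s, x i ^ 2 / N i) * ∑ i ∈ s, y i ^ 2 * N i := by
        congr 1 <;> refine Finset.sum_congr rfl fun i _ => ?_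
        · rw [div_pow, sq_abs, Real.sq_sqrt (hN i).le]
        · rw [mul_pow, sq_abs, Real.sq_sqrt (hN i).le]
    _ ≤ _ := by
        have h1 : ∀ i, 0 ≤ x i ^ 2 / N i := fun i => by have := hN i; positivity
        have h2 : ∀ i, 0 ≤ y i ^ 2 * N i := fun i => by have := hN i; positivity
        exact mul_le_mul (hx.sum_le_tsum s fun i _ => h1 i) (hy.sum_le_tsum s fun i _ => h2 i)
          (Finset.sum_nonneg fun i _ => h2 i) (tsum_nonneg h1)

/-- Energy estimate for a solution of the diagonal-plus-form system `(N - 1) g + e = r`. -/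
lemma energy_bound {ι : Type*} {N g e r : ι → ℝ} {q : ℝ} (hN : ∀ i, 1 ≤ N i)
    (heq : ∀ i, (N i - 1) * g i + e i = r i) (hg : Summable fun i => g i ^ 2 * N i)
    (hr : Summable fun i => r i ^ 2 / N i)
    (hq : 0 ≤ q)
    (hcoer : q * ∑' i, g i ^ 2 * N i ≤ ∑' i, ((N i - 1) * g i ^ 2 + e i * g i)) :
    q ^ 2 * ∑' i, g i ^ 2 * N i ≤ ∑' i, r i ^ 2 / N i := by
  have hN0 : ∀ i, 0 < N i := fun i => zero_lt_one.trans_le (hN i)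
  obtain ⟨h1, h2⟩ := summable_mul_and_tsum_sq_le hN0 hr hg
  set S := ∑' i, g i ^ 2 * N i
  have hS : 0 ≤ S := tsum_nonneg fun i => by have := hN0 i; positivity
  have h3 : q * S ≤ ∑' i, |r i * g i| := by
    refine hcoer.trans ?_
    -- The equation is tested against `g`; Cauchy–Schwarz with weight `N` then gives (qS)² ≤ (∑
    -- r²/N) S, and one factor S cancels unless S = 0.
    have e1 : ∀ i, (N i - 1) * g i ^ 2 + e i * g i = r i * g i := fun i => by
      rw [← heq]; ring
    simp_rw [e1]
    exact Summable.tsum_le_tsum (fun i => le_abs_self _) h1.of_abs h1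
  have h4 : (q * S) ^ 2 ≤ (∑' i, r i ^ 2 / N i) * S :=
    (pow_le_pow_left₀ (by positivity) h3 2).trans h2
  rcases hS.eq_or_lt with h0 | h0
  · rw [← h0, mul_zero]; exact tsum_nonneg fun i => by have := hN0 i; positivity
  · refine le_of_mul_le_mul_right ?_ h0
    calc _ = (q * S) ^ 2 := by ring
      _ ≤ _ := h4

/-- Coercivity when the form `e` is close to the identity. -/
lemma coercive_of_close {ι : Type*} {N g e v : ι → ℝ} {δ : ℝ} (hN : ∀ i, 1 ≤ N i)
    (hv : ∀ i, 0 ≤ v i) (hδ : 0 ≤ δ)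
    (hg : Summable fun i => g i ^ 2 * N i) (hW : Summable fun i => v i ^ 2 / N i)
    (he : Summable fun i => e i * g i)
    (hclose : ∀ i, |e i - g i| ≤ δ * v i * ∑' j, v j * |g j|) :
    (1 - δ * ∑' i, v i ^ 2 / N i) * ∑' i, g i ^ 2 * N i ≤
      ∑' i, ((N i - 1) * g i ^ 2 + e i * g i) := by
  have hN0 : ∀ i, 0 < N i := fun i => zero_lt_one.trans_le (hN i)
  obtain ⟨h1, h2⟩ := summable_mul_and_tsum_sq_le hN0 hW hg
  have e1 : ∀ i, |v i * g i| = v i * |g i| := fun i => by rw [abs_mul, abs_of_nonneg (hv i)]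
  simp_rw [e1] at h1 h2
  set S := ∑' i, g i ^ 2 * N i
  set T := ∑' i, v i * |g i|
  set W := ∑' i, v i ^ 2 / N i
  have hg2 : Summable fun i => g i ^ 2 := by
    refine Summable.of_nonneg_of_le (fun i => sq_nonneg _) (fun i => ?_) hg
    exact le_mul_of_one_le_right (sq_nonneg _) (hN i)
  have hN1 : Summable fun i => (N i - 1) * g i ^ 2 := (hg.sub hg2).congr fun i => by ring
  -- Since (N - 1)g² + eg = Ng² + (e - g)g, only the deviation `e - g` is lost. Summing costs δT²,
  -- and T² ≤ WS by Cauchy–Schwarz.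
  have h3 : ∀ i, g i ^ 2 * N i - δ * T * (v i * |g i|) ≤ (N i - 1) * g i ^ 2 + e i * g i := by
    intro i
    have h4 := mul_le_mul_of_nonneg_right (hclose i) (abs_nonneg (g i))
    rw [← abs_mul] at h4
    have h5 := neg_abs_le ((e i - g i) * g i)
    nlinarith
  have h6 := Summable.tsum_le_tsum h3 (hg.sub (h1.mul_left _)) (hN1.add he)
  rw [hg.tsum_sub (h1.mul_left _), tsum_mul_left] at h6
  refine le_trans ?_ h6
  nlinarith

/-- Coercivity when the form `e` is only nonnegative. -/
lemma coercive_of_nonneg {ι : Type*} {N g e : ι → ℝ} {q : ℝ}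
    (hq : ∀ i, q * N i ≤ N i - 1) (hN : ∀ i, 1 ≤ N i)
    (hg : Summable fun i => g i ^ 2 * N i) (he : Summable fun i => e i * g i)
    (he0 : 0 ≤ ∑' i, e i * g i) :
    q * ∑' i, g i ^ 2 * N i ≤ ∑' i, ((N i - 1) * g i ^ 2 + e i * g i) := by
  have hg2 : Summable fun i => g i ^ 2 := by
    refine Summable.of_nonneg_of_le (fun i => sq_nonneg _) (fun i => ?_) hg
    exact le_mul_of_one_le_right (sq_nonneg _) (hN i)
  have hN1 : Summable fun i => (N i - 1) * g i ^ 2 := (hg.sub hg2).congr fun i => by ring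
  rw [hN1.tsum_add he, ← tsum_mul_left]
  have : ∑' i, q * (g i ^ 2 * N i) ≤ ∑' i, (N i - 1) * g i ^ 2 :=
    Summable.tsum_le_tsum (fun i => by nlinarith [hq i, sq_nonneg (g i)]) (hg.mul_left q) hN1
  linarith

/-! ### Representer form of the posterior mean -/

/-- The posterior mean as a Fourier series whose coefficients satisfy the normal equations. -/
lemma exists_posteriorMean_eq {K : ℝ → ℝ → ℝ} {μ : ℕ+ → ℝ} (hμ : ∀ m, 0 ≤ μ m)
    (hK : ∀ x ∈ Icc (0 : ℝ) 1, ∀ y ∈ Icc (0 : ℝ) 1,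
      HasSum (fun i : ℕ+ => μ i * realFourier i x * realFourier i y) (K x y))
    {n : ℕ} (hn : 0 < n) {l : ℝ} (hl : 0 < l) (D : Fin n → ℝ × ℝ)
    (hD : ∀ i, (D i).1 ∈ Icc (0 : ℝ) 1) :
    ∃ a : Fin n → ℝ,
      EqOn (posteriorMean K l D)
        (fourierSeries (fun m => μ m * ∑ i, a i * realFourier m (D i).1) 0) (Icc 0 1) ∧
      ∀ i, posteriorMean K l D (D i).1 + n * l * a i = (D i).2 := by
  set A : Matrix (Fin n) (Fin n) ℝ := (Matrix.of fun i j => K (D i).1 (D j).1) +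
    ((n : ℝ) * l) • (1 : Matrix (Fin n) (Fin n) ℝ) with hA
  set Y : Fin n → ℝ := fun i => (D i).2
  set a : Fin n → ℝ := A⁻¹.mulVec Y with ha
  have hpm : ∀ x, posteriorMean K l D x = ∑ i, K x (D i).1 * a i := fun x => rfl
  have hnl : 0 < (n : ℝ) * l := by positivity
  have hKs : ∀ x ∈ Icc (0 : ℝ) 1, ∀ b : Fin n → ℝ,
      HasSum (fun m => μ m * (∑ i, b i * realFourier m (D i).1) * realFourier m x)
        (∑ i, K x (D i).1 * b i) := fun x hx b => by
    have := hasSum_sum (s := Finset.univ) fun i _ => (hK x hx _ (hD i)).mul_right (b i)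
    refine this.congr_fun fun m => ?_
    rw [Finset.mul_sum, Finset.sum_mul]
    exact Finset.sum_congr rfl fun i _ => by ring
  -- The kernel matrix is positive semidefinite, its form being ∑ μ_m (∑ b_j ψ_m(X_j))². A null
  -- vector `b` would therefore satisfy n l |b|² ≤ 0.
  have hunit : IsUnit A.det := by
    rw [isUnit_iff_ne_zero]
    intro hdet
    obtain ⟨b, hb, hb0⟩ := Matrix.exists_mulVec_eq_zero_iff.2 hdet
    have hq : ∀ i, ∑ j, K (D i).1 (D j).1 * b j + n * l * b i = 0 := fun i => by
      have := congrFun hb0 i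
      rw [hA, Matrix.add_mulVec, Matrix.smul_mulVec, Matrix.one_mulVec] at this
      simpa [Matrix.mulVec, dotProduct] using this
    have h1 := hasSum_sum (s := Finset.univ) fun i _ => (hKs _ (hD i) b).mul_left (b i)
    have h2 : 0 ≤ ∑ i, b i * ∑ j, K (D i).1 (D j).1 * b j := by
      refine h1.nonneg fun m => ?_
      have : ∑ i, b i * (μ m * (∑ j, b j * realFourier m (D j).1) * realFourier m (D i).1) =
          μ m * (∑ j, b j * realFourier m (D j).1) ^ 2 := by
        rw [sq, ← mul_assoc]
        conv_rhs => rw [Finset.mul_sum]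
        exact Finset.sum_congr rfl fun i _ => by ring
      rw [this]
      exact mul_nonneg (hμ m) (sq_nonneg _)
    have h3 : ∑ i, b i * ∑ j, K (D i).1 (D j).1 * b j = -(n * l * ∑ i, b i ^ 2) := by
      rw [Finset.mul_sum, ← Finset.sum_neg_distrib]
      refine Finset.sum_congr rfl fun i _ => ?_
      rw [eq_neg_of_add_eq_zero_left (hq i)]; ring
    have h4 : ∑ i, b i ^ 2 = 0 := by
      have := Finset.sum_nonneg fun i (_ : i ∈ Finset.univ) => sq_nonneg (b i)
      nlinarith
    refine hb (funext fun i => ?_)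
    have := (Finset.sum_eq_zero_iff_of_nonneg fun i _ => sq_nonneg (b i)).1 h4 i
      (Finset.mem_univ i)
    simpa using this
  refine ⟨a, fun x hx => ?_, fun i => ?_⟩
  · rw [hpm, ← (hKs x hx a).tsum_eq, fourierSeries]
    simp_rw [realFourier_eq_fourierDeriv]
  · have h1 : A.mulVec a = Y := by
      rw [ha, Matrix.mulVec_mulVec, Matrix.mul_nonsing_inv _ hunit, Matrix.one_mulVec]
    have h2 := congrFun h1 i
    rw [hA, Matrix.add_mulVec, Matrix.smul_mulVec, Matrix.one_mulVec] at h2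
    rw [hpm]
    simpa [Matrix.mulVec, dotProduct] using h2

/-! ### Effective dimension: sums against the weights 1/N_m -/

lemma summable_pnat_pow_mul_exp {γ : ℝ} (hγ : 0 < γ) (p : ℕ) :
    Summable fun j : ℕ+ => (j : ℝ) ^ p * Real.exp (-γ * j) := by
  have := Real.summable_pow_mul_exp_neg_nat_mul p hγ
  exact this.comp_injective PNat.coe_injective

lemma sum_ite_le_le {t D : ℝ} (ht : 0 ≤ t) (hD : 0 ≤ D) (s : Finset ℕ+) :
    ∑ j ∈ s, (if (j : ℝ) ≤ t then D else 0) ≤ D * t := by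
  rw [← Finset.sum_filter, Finset.sum_const, nsmul_eq_mul, mul_comm]
  refine mul_le_mul_of_nonneg_left ?_ hD
  have h : (s.filter fun j : ℕ+ => (j : ℝ) ≤ t).card ≤ (Finset.Icc 1 ⌊t⌋₊).card := by
    refine Finset.card_le_card_of_injOn (fun j : ℕ+ => (j : ℕ)) (fun j hj => ?_)
      PNat.coe_injective.injOn
    have hj' := (Finset.mem_filter.1 (Finset.mem_coe.1 hj)).2
    rw [Finset.mem_coe, Finset.mem_Icc]
    exact ⟨j.pos, Nat.le_floor hj'⟩
  rw [Nat.card_Icc, Nat.add_sub_cancel] at h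
  exact (Nat.cast_le.2 h).trans (Nat.floor_le ht)

/-- The cutoff j = L/γ is where half of the exponent 2γj absorbs e^L; the other half remains as
decay. In the application w = 1/N_j and L = log n. -/
lemma weight_le {γ A L w : ℝ} {j : ℕ+} (hA : 0 ≤ A) (hw1 : w ≤ 1)
    (hwA : w ≤ A * Real.exp (L - 2 * γ * j)) (hγ : 0 < γ) :
    w ≤ if (j : ℝ) ≤ L / γ then 1 else A * Real.exp (-γ * j) := by
  split_ifs with h
  · exact hw1
  · refine hwA.trans ?_
    rw [not_le, div_lt_iff₀ hγ] at h
    gcongr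
    nlinarith

/-- This is the price of derivatives. Below the cutoff j^p ≤ (L/γ)^p; above it j^p e^{-γj} is
bounded, and L ≥ log 2 absorbs the constant. -/
lemma pow_mul_weight_le {γ A : ℝ} (hγ : 0 < γ) (hA : 0 ≤ A) (p : ℕ) :
    ∃ C : ℝ, 0 < C ∧ ∀ (L : ℝ) (w : ℝ) (j : ℕ+), Real.log 2 ≤ L → w ≤ 1 →
      w ≤ A * Real.exp (L - 2 * γ * j) → (j : ℝ) ^ p * w ≤ C * L ^ p := by
  have hl2 : 0 < Real.log 2 := Real.log_pos one_lt_two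
  set B := ∑' j : ℕ+, (j : ℝ) ^ p * Real.exp (-γ * j)
  have hs := summable_pnat_pow_mul_exp hγ p
  have hB : 0 ≤ B := tsum_nonneg fun j => by positivity
  refine ⟨(1 / γ) ^ p + A * B / Real.log 2 ^ p, by positivity, fun L w j hL hw1 hwA => ?_⟩
  have hL0 : 0 < L := hl2.trans_le hL
  have h := weight_le hA hw1 hwA hγ
  rw [add_mul]
  split_ifs at h with hj
  · calc (j : ℝ) ^ p * w ≤ (j : ℝ) ^ p * 1 := by gcongr
      _ ≤ (L / γ) ^ p := by rw [mul_one]; gcongr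
      _ = (1 / γ) ^ p * L ^ p := by rw [← mul_pow]; congr 1; ring
      _ ≤ _ := le_add_of_nonneg_right (by positivity)
  · calc (j : ℝ) ^ p * w ≤ (j : ℝ) ^ p * (A * Real.exp (-γ * j)) := by gcongr
      _ = A * ((j : ℝ) ^ p * Real.exp (-γ * j)) := by ring
      _ ≤ A * B := by
        gcongr; exact hs.le_tsum j fun i _ => by positivity
      _ = A * B / Real.log 2 ^ p * Real.log 2 ^ p := by field_simp
      _ ≤ A * B / Real.log 2 ^ p * L ^ p := by gcongr
      _ ≤ _ := le_add_of_nonneg_left (by positivity)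

/-- About L/γ indices lie below the cutoff, each contributing O(L); the tail contributes only O(L).
The factor `12 * L + 2 * j` is `devWeight` at L = log n. -/
lemma summable_mul_weight {γ A : ℝ} (hγ : 0 < γ) (hA : 0 ≤ A) :
    ∃ C : ℝ, 0 < C ∧ ∀ (L : ℝ) (w : ℕ+ → ℝ), Real.log 2 ≤ L → (∀ j, 0 ≤ w j) →
      (∀ j, w j ≤ 1) → (∀ j : ℕ+, w j ≤ A * Real.exp (L - 2 * γ * j)) →
      Summable (fun j : ℕ+ => (12 * L + 2 * j) * w j) ∧
        ∑' j : ℕ+, (12 * L + 2 * j) * w j ≤ C * L ^ 2 := by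
  have hl2 : 0.6931471803 < Real.log 2 := Real.log_two_gt_d9
  have hs0 := summable_pnat_pow_mul_exp hγ 0
  have hs1 := summable_pnat_pow_mul_exp hγ 1
  have hs : Summable fun j : ℕ+ => (12 + 3 * (j : ℝ)) * Real.exp (-γ * j) :=
    ((hs0.mul_left 12).add (hs1.mul_left 3)).congr fun j => by ring
  set B := ∑' j : ℕ+, (12 + 3 * (j : ℝ)) * Real.exp (-γ * j)
  have hB : 0 ≤ B := tsum_nonneg fun j => by positivity
  refine ⟨(12 + 2 / γ) / γ + A * B * 2, by positivity, fun L w hL hw0 hw1 hwA => ?_⟩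
  have hL0 : 0 < L := by linarith
  have hterm : ∀ j : ℕ+, (12 * L + 2 * j) * w j ≤
      (if (j : ℝ) ≤ L / γ then (12 + 2 / γ) * L else 0) +
        A * L * ((12 + 3 * (j : ℝ)) * Real.exp (-γ * j)) := fun j => by
    have h := weight_le hA (hw1 j) (hwA j) hγ
    split_ifs at h ⊢ with hj
    · calc (12 * L + 2 * j) * w j ≤ (12 * L + 2 * (L / γ)) * 1 := by
            gcongr; exact hw0 j
        _ = (12 + 2 / γ) * L := by ring
        _ ≤ _ := le_add_of_nonneg_right (by positivity)
    · have hj0 : (0 : ℝ) < j := by exact_mod_cast j.pos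
      calc (12 * L + 2 * j) * w j ≤ (L * (12 + 3 * j)) * (A * Real.exp (-γ * j)) := by
            gcongr
            · exact hw0 j
            · nlinarith
        _ = _ := by ring
  have hsum : ∀ s : Finset ℕ+, ∑ j ∈ s, (12 * L + 2 * j) * w j ≤
      ((12 + 2 / γ) / γ + A * B * 2) * L ^ 2 := fun s => by
    calc _ ≤ ∑ j ∈ s, ((if (j : ℝ) ≤ L / γ then (12 + 2 / γ) * L else 0) +
          A * L * ((12 + 3 * (j : ℝ)) * Real.exp (-γ * j))) :=
          Finset.sum_le_sum fun j _ => hterm j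
      _ ≤ (12 + 2 / γ) * L * (L / γ) + A * L * B := by
          rw [Finset.sum_add_distrib, ← Finset.mul_sum]
          gcongr
          · exact sum_ite_le_le (by positivity) (by positivity) s
          · exact hs.sum_le_tsum s fun j _ => by positivity
      _ ≤ _ := by
          have : A * L * B ≤ A * B * 2 * L ^ 2 := by
            have : 0 ≤ A * B * L := by positivity
            nlinarith
          calc _ ≤ (12 + 2 / γ) * L * (L / γ) + A * B * 2 * L ^ 2 := by gcongr
            _ = _ := by ring
  have hnn : ∀ j : ℕ+, 0 ≤ (12 * L + 2 * j) * w j := fun j => mul_nonneg (by positivity) (hw0 j)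
  exact ⟨summable_of_sum_le hnn hsum, Real.tsum_le_of_sum_le hnn hsum⟩

/-! ### Concentration of the noise and of the Gram matrix -/

lemma measure_abs_sum_ge_le {Ω : Type*} [MeasurableSpace Ω] {P : Measure Ω}
    [IsProbabilityMeasure P] {φ : Ω → ℝ} {c : NNReal} (hφ : HasSubgaussianMGF φ c P) {n : ℕ}
    {t : ℝ} (ht : 0 ≤ t) :
    (Measure.pi fun _ : Fin n => P).real {D | t ≤ |∑ i, φ (D i)|} ≤
      2 * Real.exp (-t ^ 2 / (2 * (n * c))) := by
  have hmp : ∀ i : Fin n, MeasurePreserving (fun D : Fin n → Ω => D i)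
      (Measure.pi fun _ => P) P := fun i => measurePreserving_eval _ i
  have key : ∀ {φ : Ω → ℝ}, HasSubgaussianMGF φ c P →
      (Measure.pi fun _ : Fin n => P).real {D | t ≤ ∑ i, φ (D i)} ≤
        Real.exp (-t ^ 2 / (2 * (n * c))) := fun {φ} hφ => by
    have hind : iIndepFun (fun (i : Fin n) (D : Fin n → Ω) => φ (D i))
        (Measure.pi fun _ => P) := iIndepFun_pi fun _ => hφ.aemeasurable
    have h := HasSubgaussianMGF.measure_sum_ge_le_of_iIndepFun hind (c := fun _ => c)
      (s := Finset.univ) (fun i _ => HasSubgaussianMGF.of_map (Y := fun D : Fin n → Ω => D i)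
        (hmp i).aemeasurable (by rwa [(hmp i).map_eq])) ht
    simpa using h
  have hsub : {D : Fin n → Ω | t ≤ |∑ i, φ (D i)|} ⊆
      {D | t ≤ ∑ i, φ (D i)} ∪ {D | t ≤ ∑ i, (-φ) (D i)} := fun D hD => by
    rcases le_abs.1 (show t ≤ |∑ i, φ (D i)| from hD) with h | h
    · exact Or.inl h
    · right
      simpa using h
  calc _ ≤ _ := measureReal_mono hsub
    _ ≤ _ := measureReal_union_le _ _
    _ ≤ _ := by linarith [key hφ, key hφ.neg]

section Observation

variable {F : ℝ → ℝ} {σ : ℝ}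

lemma measurable_observation (hF : Measurable F) :
    Measurable fun p : ℝ × ℝ => (p.1, F p.1 + p.2) := by fun_prop

lemma isProbabilityMeasure_observationLaw (hF : Measurable F) (σ : ℝ) :
    IsProbabilityMeasure (observationLaw F σ) :=
  Measure.isProbabilityMeasure_map (measurable_observation hF).aemeasurable

/-- Given X = x, the variable εψ_j(x) is Gaussian with variance σ²ψ_j(x)² ≤ 2σ². Its conditional
moment generating function is bounded uniformly in x, then integrated over x. -/
lemma hasSubgaussianMGF_noise (hF : Measurable F) (j : ℕ+) :
    HasSubgaussianMGF (fun p : ℝ × ℝ => (p.2 - F p.1) * realFourier j p.1)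
      (2 * Real.toNNReal (σ ^ 2)) (observationLaw F σ) := by
  set G := gaussianReal 0 (Real.toNNReal (σ ^ 2)) with hG
  have hψ : Measurable (realFourier j) := (continuous_realFourier j).measurable
  have hint : ∀ t : ℝ, Integrable (fun p : ℝ × ℝ => Real.exp (t * (p.2 * realFourier j p.1)))
      (uniform01.prod G) := fun t => by
    have h1 : Integrable (fun p : ℝ × ℝ => Real.exp ((|t| * √2) * p.2) +
        Real.exp (-(|t| * √2) * p.2)) (uniform01.prod G) :=
      ((integrable_exp_mul_gaussianReal (|t| * √2)).comp_snd uniform01).add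
        ((integrable_exp_mul_gaussianReal (-(|t| * √2))).comp_snd uniform01)
    refine h1.mono' (by fun_prop) (ae_of_all _ fun p => ?_)
    rw [Real.norm_eq_abs, Real.abs_exp]
    have h2 : t * (p.2 * realFourier j p.1) ≤ |t| * √2 * |p.2| := by
      refine (le_abs_self _).trans ?_
      rw [abs_mul, abs_mul]
      calc _ ≤ |t| * (|p.2| * √2) := by gcongr; exact abs_realFourier_le j _
        _ = _ := by ring
    refine (Real.exp_le_exp.2 h2).trans ?_
    rcases abs_cases p.2 with ⟨h, -⟩ | ⟨h, -⟩ <;> rw [h]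
    · exact le_add_of_nonneg_right (Real.exp_pos _).le
    · rw [mul_neg, ← neg_mul]; exact le_add_of_nonneg_left (Real.exp_pos _).le
  have hcomp : ∀ t : ℝ, ((fun p : ℝ × ℝ => Real.exp (t * ((p.2 - F p.1) * realFourier j p.1))) ∘
      fun p : ℝ × ℝ => (p.1, F p.1 + p.2)) =
      fun p : ℝ × ℝ => Real.exp (t * (p.2 * realFourier j p.1)) := fun t => by
    ext p; simp
  have hm : ∀ t : ℝ, Measurable fun p : ℝ × ℝ =>
      Real.exp (t * ((p.2 - F p.1) * realFourier j p.1)) := fun t => by fun_prop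
  refine ⟨fun t => ?_, fun t => ?_⟩
  · rw [observationLaw, integrable_map_measure (hm t).aestronglyMeasurable
      (measurable_observation hF).aemeasurable, hcomp]
    exact hint t
  · rw [mgf, observationLaw, integral_map (measurable_observation hF).aemeasurable
      (hm t).aestronglyMeasurable]
    have h3 := hcomp t
    simp only [Function.comp_def] at h3
    rw [h3, integral_prod _ (hint t)]
    have h4 : ∀ x, ∫ y, Real.exp (t * (y * realFourier j x)) ∂G =
        Real.exp (σ ^ 2 * (t * realFourier j x) ^ 2 / 2) := fun x => by
      have := mgf_gaussianReal (X := id) (p := G) (μ := 0) (v := Real.toNNReal (σ ^ 2))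
        (by rw [Measure.map_id]) (t * realFourier j x)
      rw [mgf, Real.coe_toNNReal _ (sq_nonneg σ), zero_mul, zero_add] at this
      rw [← this]
      congr 1; ext y; simp only [id]; congr 1; ring
    simp_rw [h4]
    have h5 : ∀ x, Real.exp (σ ^ 2 * (t * realFourier j x) ^ 2 / 2) ≤
        Real.exp (((2 * Real.toNNReal (σ ^ 2) : NNReal) : ℝ) * t ^ 2 / 2) := fun x => by
      have h6 : realFourier j x ^ 2 ≤ 2 := by
        rw [← sq_abs]
        calc _ ≤ √2 ^ 2 := by gcongr; exact abs_realFourier_le j x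
          _ = 2 := Real.sq_sqrt (by norm_num)
      rw [NNReal.coe_mul, Real.coe_toNNReal _ (sq_nonneg σ)]
      refine Real.exp_le_exp.2 (div_le_div_of_nonneg_right ?_ zero_le_two)
      rw [mul_pow]
      have := mul_le_mul_of_nonneg_left h6 (by positivity : 0 ≤ σ ^ 2 * t ^ 2)
      simp only [NNReal.coe_ofNat]
      linarith
    calc _ ≤ ∫ x, Real.exp (((2 * Real.toNNReal (σ ^ 2) : NNReal) : ℝ) * t ^ 2 / 2) ∂uniform01 := by
          refine integral_mono_of_nonneg (ae_of_all _ fun x => (Real.exp_pos _).le)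
            (integrable_const _) (ae_of_all _ h5)
      _ = _ := by simp

lemma map_fst_observationLaw (hF : Measurable F) :
    (observationLaw F σ).map Prod.fst = uniform01 := by
  rw [observationLaw, Measure.map_map measurable_fst (measurable_observation hF)]
  exact (measurePreserving_fst (μ := uniform01)
    (ν := gaussianReal 0 (Real.toNNReal (σ ^ 2)))).map_eq

/-- Hoeffding's lemma: the product lies in [-2, 2], whose half-length squared is 4, and
orthonormality identifies its mean. -/
lemma hasSubgaussianMGF_gram (hF : Measurable F) (j l : ℕ+) :
    HasSubgaussianMGF (fun p : ℝ × ℝ => realFourier j p.1 * realFourier l p.1 -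
      if j = l then 1 else 0) 4 (observationLaw F σ) := by
  have h : HasSubgaussianMGF (fun x => realFourier j x * realFourier l x -
      if j = l then 1 else 0) 4 uniform01 := by
    have hm : Measurable fun x => realFourier j x * realFourier l x :=
      (continuous_realFourier j).measurable.mul (continuous_realFourier l).measurable
    have h1 := hasSubgaussianMGF_of_mem_Icc (μ := uniform01) (a := -2) (b := 2)
      hm.aemeasurable (ae_of_all _ fun x => ?_)
    · rw [integral_realFourier_mul] at h1
      convert h1 using 1
      ext
      norm_num
    · rw [mem_Icc, ← abs_le, abs_mul]
      calc _ ≤ √2 * √2 := by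
            gcongr
            · exact abs_realFourier_le j x
            · exact abs_realFourier_le l x
        _ = 2 := Real.mul_self_sqrt (by norm_num)
  rw [← map_fst_observationLaw (σ := σ) hF] at h
  exact HasSubgaussianMGF.of_map measurable_fst.aemeasurable h

end Observation

/-- The growth weight `12 log n + 2 j` in the deviation bounds. -/
def devWeight (n : ℕ) (j : ℕ+) : ℝ := 12 * Real.log n + 2 * j

lemma two_le_devWeight (n : ℕ) (j : ℕ+) : 2 ≤ devWeight n j := by
  have : (1 : ℝ) ≤ j := by exact_mod_cast (one_le : 1 ≤ j)
  have : 0 ≤ Real.log n := Real.log_natCast_nonneg n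
  unfold devWeight; linarith

/-- The summand is n⁻¹² e^{-2j}, and e^{-2} ≤ 1/2 compares it with a geometric series of sum 1. The
part `12 * log n` supplies the probability, the part `2 * j` the convergence. -/
lemma tsum_exp_neg_devWeight_le {n : ℕ} (hn : 2 ≤ n) :
    Summable (fun j => Real.exp (-devWeight n j)) ∧
      ∑' j, Real.exp (-devWeight n j) ≤ 1 / (n : ℝ) ^ 12 := by
  have hn0 : (0 : ℝ) < n := by positivity
  have h : ∀ j : ℕ+, Real.exp (-devWeight n j) ≤ 1 / (n : ℝ) ^ 12 * (1 / 2) ^ (j : ℕ) := fun j => by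
    have h1 : Real.exp (-devWeight n j) = 1 / (n : ℝ) ^ 12 * Real.exp (-2) ^ (j : ℕ) := by
      rw [← Real.exp_nat_mul, devWeight, neg_add, Real.exp_add]
      congr 1
      · rw [Real.exp_neg, one_div]
        congr 1
        rw [show (12 : ℝ) * Real.log n = (12 : ℕ) * Real.log n by norm_num, Real.exp_nat_mul,
          Real.exp_log hn0]
      · congr 1; ring
    rw [h1]
    gcongr
    rw [Real.exp_neg, one_div]
    gcongr
    have := Real.add_one_le_exp (2 : ℝ)
    linarith
  have hg : HasSum (fun j : ℕ+ => (1 / 2 : ℝ) ^ (j : ℕ)) 1 := by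
    have h2 : Summable fun j : ℕ+ => (1 / 2 : ℝ) ^ (j : ℕ) :=
      summable_geometric_two.comp_injective PNat.coe_injective
    have h3 : ∑' j : ℕ+, (1 / 2 : ℝ) ^ (j : ℕ) = 1 := by
      rw [tsum_pnat_eq_tsum_succ (f := fun j => (1 / 2 : ℝ) ^ j)]
      simp_rw [pow_succ]
      rw [tsum_mul_right, tsum_geometric_two]; norm_num
    have := h2.hasSum
    rwa [h3] at this
  have hs := Summable.of_nonneg_of_le (fun j => (Real.exp_pos _).le) h (hg.summable.mul_left _)
  refine ⟨hs, (Summable.tsum_le_tsum h hs (hg.summable.mul_left _)).trans ?_⟩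
  rw [tsum_mul_left, hg.tsum_eq, mul_one]

/-- The event on which the noise and the empirical Gram matrix of the Fourier basis deviate little
from their means. -/
def goodEvent (F : ℝ → ℝ) (σ : ℝ) (n : ℕ) : Set (Fin n → ℝ × ℝ) :=
  {D | (∀ i, (D i).1 ∈ Icc (0 : ℝ) 1) ∧
    (∀ j, |∑ i, ((D i).2 - F (D i).1) * realFourier j (D i).1| ≤
      √(4 * n * σ ^ 2 * devWeight n j)) ∧
    ∀ j l, |∑ i, (realFourier j (D i).1 * realFourier l (D i).1 - if j = l then 1 else 0)| ≤
      √(8 * n * (devWeight n j * devWeight n l))}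

lemma measure_compl_goodEvent_le {F : ℝ → ℝ} (hF : Measurable F) {σ : ℝ} (hσ : 0 < σ) {n : ℕ}
    (hn : 2 ≤ n) :
    sampleLaw F σ n (goodEvent F σ n)ᶜ ≤ ENNReal.ofReal (1 / (n : ℝ) ^ 10) := by
  have := isProbabilityMeasure_observationLaw hF σ
  have hn0 : (0 : ℝ) < n := by positivity
  set P := sampleLaw F σ n with hP
  have hPp : IsProbabilityMeasure P := by rw [hP, sampleLaw]; infer_instance
  have hd := two_le_devWeight n
  set A : Set (Fin n → ℝ × ℝ) := {D | ¬ ∀ i, (D i).1 ∈ Icc (0 : ℝ) 1}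
  set B : ℕ+ → Set (Fin n → ℝ × ℝ) := fun j => {D | √(4 * n * σ ^ 2 * devWeight n j) ≤
    |∑ i, ((D i).2 - F (D i).1) * realFourier j (D i).1|}
  set E : ℕ+ × ℕ+ → Set (Fin n → ℝ × ℝ) := fun q =>
    {D | √(8 * n * (devWeight n q.1 * devWeight n q.2)) ≤
      |∑ i, (realFourier q.1 (D i).1 * realFourier q.2 (D i).1 - if q.1 = q.2 then 1 else 0)|}
  have hsub : (goodEvent F σ n)ᶜ ⊆ A ∪ ((⋃ j, B j) ∪ ⋃ q, E q) := fun D hD => by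
    by_contra hne
    simp only [mem_union, mem_iUnion, not_or, not_exists] at hne
    obtain ⟨h1, h2, h3⟩ := hne
    exact hD ⟨not_not.1 h1, fun j => (not_le.1 (h2 j)).le, fun j l => (not_le.1 (h3 (j, l))).le⟩
  have hA : P A = 0 := by
    have h1 : ∀ i : Fin n, ∀ᵐ D ∂P, (D i).1 ∈ Icc (0 : ℝ) 1 := fun i => by
      have h2 : ∀ᵐ p ∂(observationLaw F σ), p.1 ∈ Icc (0 : ℝ) 1 := by
        have := ae_uniform01_mem
        rw [← map_fst_observationLaw (σ := σ) hF] at this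
        exact ae_of_ae_map measurable_fst.aemeasurable this
      exact (Measure.quasiMeasurePreserving_eval (fun _ : Fin n => observationLaw F σ) i).ae h2
    exact ae_all_iff.2 h1
  have hB : ∀ j, P (B j) ≤ ENNReal.ofReal (2 * Real.exp (-devWeight n j)) := fun j => by
    have h1 := measure_abs_sum_ge_le (n := n) (hasSubgaussianMGF_noise (σ := σ) hF j)
      (Real.sqrt_nonneg (4 * n * σ ^ 2 * devWeight n j))
    rw [← ofReal_measureReal]
    refine ENNReal.ofReal_le_ofReal (h1.trans_eq ?_)
    have := hd j
    rw [Real.sq_sqrt (by positivity), NNReal.coe_mul, Real.coe_toNNReal _ (sq_nonneg σ)]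
    congr 2
    simp only [NNReal.coe_ofNat]
    field_simp; norm_num
  have hE : ∀ q, P (E q) ≤ ENNReal.ofReal
      (2 * (Real.exp (-devWeight n q.1) * Real.exp (-devWeight n q.2))) := fun q => by
    have h1 := measure_abs_sum_ge_le (n := n) (hasSubgaussianMGF_gram (σ := σ) hF q.1 q.2)
      (Real.sqrt_nonneg (8 * n * (devWeight n q.1 * devWeight n q.2)))
    rw [← ofReal_measureReal]
    refine ENNReal.ofReal_le_ofReal (h1.trans ?_)
    have e1 := hd q.1
    have e2 := hd q.2
    rw [Real.sq_sqrt (by positivity), ← Real.exp_add]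
    have : -(8 * n * (devWeight n q.1 * devWeight n q.2)) / (2 * (n * ((4 : NNReal) : ℝ))) =
      -(devWeight n q.1 * devWeight n q.2) := by
      simp only [NNReal.coe_ofNat]
      field_simp; norm_num
    -- The Gram level yields exp(-d_j d_l). As both weights are at least 2, d_j d_l ≥ d_j + d_l, so
    -- the bound factors and the double sum is a product.
    rw [this]
    gcongr
    nlinarith
  obtain ⟨hs, hsle⟩ := tsum_exp_neg_devWeight_le hn
  set s := ∑' j, Real.exp (-devWeight n j)
  have hs0 : 0 ≤ s := tsum_nonneg fun j => (Real.exp_pos _).le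
  have hBU : P (⋃ j, B j) ≤ ENNReal.ofReal (2 * s) := by
    refine (measure_iUnion_le _).trans ((ENNReal.tsum_le_tsum hB).trans_eq ?_)
    rw [← ENNReal.ofReal_tsum_of_nonneg (fun j => by positivity) (hs.mul_left 2), tsum_mul_left]
  have hEU : P (⋃ q, E q) ≤ ENNReal.ofReal (2 * (s * s)) := by
    have hss := hs.mul_of_nonneg hs (fun j => (Real.exp_pos _).le) fun j => (Real.exp_pos _).le
    refine (measure_iUnion_le _).trans ((ENNReal.tsum_le_tsum hE).trans_eq ?_)
    rw [← ENNReal.ofReal_tsum_of_nonneg (fun q => by positivity) (hss.mul_left 2), tsum_mul_left,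
      hs.tsum_mul_tsum hs hss]
  calc P (goodEvent F σ n)ᶜ ≤ P A + (P (⋃ j, B j) + P (⋃ q, E q)) :=
        (measure_mono hsub).trans ((measure_union_le _ _).trans
          (add_le_add le_rfl (measure_union_le _ _)))
    _ ≤ ENNReal.ofReal (2 * s + 2 * (s * s)) := by
        rw [hA, zero_add, ENNReal.ofReal_add (by positivity) (by positivity)]
        exact add_le_add hBU hEU
    _ ≤ _ := by
        refine ENNReal.ofReal_le_ofReal ?_
        have hn2 : (2 : ℝ) ≤ n := by exact_mod_cast hn
        have h1 : 1 / (n : ℝ) ^ 12 ≤ 1 := by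
          rw [div_le_one (by positivity)]; exact one_le_pow₀ (by linarith)
        -- With s ≤ n⁻¹² ≤ 1 the total 2s + 2s² is at most 4n⁻¹², and 4 ≤ n².
        have h2 : 4 * (1 / (n : ℝ) ^ 12) ≤ 1 / (n : ℝ) ^ 10 := by
          rw [mul_one_div, div_le_div_iff₀ (by positivity) (by positivity)]
          have : (4 : ℝ) ≤ (n : ℝ) ^ 2 := by nlinarith
          calc (4 : ℝ) * n ^ 10 ≤ n ^ 2 * n ^ 10 := by gcongr
            _ = _ := by ring
        nlinarith

/-! ### Energy of the regression error on the good event -/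

lemma rapidDecay_of_abs_le_exp {a : ℕ+ → ℝ} {B γ : ℝ} (hγ : 0 < γ)
    (h : ∀ i : ℕ+, |a i| ≤ B * Real.exp (-γ * i)) : RapidDecay a := fun k => by
  refine Summable.of_nonneg_of_le
    (fun i => mul_nonneg (abs_nonneg _) (pow_nonneg (fourierFreq_nonneg i) k)) (fun i => ?_)
    ((summable_pnat_pow_mul_exp hγ k).mul_left (B * Real.pi ^ k))
  have := Real.pi_pos
  calc |a i| * fourierFreq i ^ k ≤ (B * Real.exp (-γ * i)) * (Real.pi * i) ^ k := by
        refine mul_le_mul (h i) (pow_le_pow_left₀ (fourierFreq_nonneg i) (fourierFreq_le i) k)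
          (pow_nonneg (fourierFreq_nonneg i) k) ((abs_nonneg _).trans (h i))
    _ = _ := by rw [mul_pow]; ring

lemma AnalyticClass.exists_abs_coef_le {g : ℝ} {f : ℝ → ℝ} (hf : AnalyticClass g f) :
    ∃ B : ℝ, ∀ i : ℕ+, |realFourierCoef f i| ≤ B * Real.exp (-g * i) := by
  refine ⟨∑' i : ℕ+, Real.exp (g * i) * |realFourierCoef f i|, fun i => ?_⟩
  have h := hf.2.le_tsum i fun j _ => by positivity
  rw [neg_mul, Real.exp_neg, ← div_eq_mul_inv, le_div_iff₀ (Real.exp_pos _), mul_comm]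
  exact h

/-- Nothing is known of f₀ outside [0,1]. This allows replacing it by its Fourier series, which is
continuous on ℝ and hence measurable. -/
lemma observationLaw_congr {f F : ℝ → ℝ} (h : EqOn f F (Icc 0 1)) (σ : ℝ) :
    observationLaw f σ = observationLaw F σ := by
  refine Measure.map_congr ?_
  have := Measure.quasiMeasurePreserving_fst (μ := uniform01)
    (ν := gaussianReal 0 (Real.toNNReal (σ ^ 2))) |>.ae ae_uniform01_mem
  filter_upwards [this] with p hp
  rw [h hp]

/-- On the good event the regression error has small energy. -/
lemma energy_le_of_mem_goodEvent {K : ℝ → ℝ → ℝ} {μ c : ℕ+ → ℝ} {γ c₂ σ : ℝ} (hγ : 0 < γ)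
    (hμ : ∀ m, 0 < μ m) (hμ₂ : ∀ m : ℕ+, μ m ≤ c₂ * Real.exp (-2 * γ * m))
    (hK : ∀ x ∈ Icc (0 : ℝ) 1, ∀ y ∈ Icc (0 : ℝ) 1,
      HasSum (fun i : ℕ+ => μ i * realFourier i x * realFourier i y) (K x y))
    (hc : RapidDecay c) (hcμ : Summable fun m => c m ^ 2 / μ m)
    {n : ℕ} (hn : 0 < n) {l : ℝ} (hl : 0 < l) {D : Fin n → ℝ × ℝ}
    (hD : D ∈ goodEvent (fourierSeries c 0) σ n) {q : ℝ} (hq : 0 ≤ q)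
    (hW : Summable fun m => devWeight n m / (1 + l / μ m))
    (hcoer : (∀ m, q * (1 + l / μ m) ≤ l / μ m) ∨
      q ≤ 1 - √(8 * n) / n * ∑' m, devWeight n m / (1 + l / μ m)) :
    ∃ θ : ℕ+ → ℝ, RapidDecay θ ∧ EqOn (posteriorMean K l D) (fourierSeries θ 0) (Icc 0 1) ∧
      (Summable fun m => (θ m - c m) ^ 2 * (1 + l / μ m)) ∧
      q ^ 2 * ∑' m, (θ m - c m) ^ 2 * (1 + l / μ m) ≤
        8 * σ ^ 2 / n * (∑' m, devWeight n m / (1 + l / μ m)) +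
          2 * l * ∑' m, c m ^ 2 / μ m := by
  obtain ⟨hX, hZ, hΔ⟩ := hD
  have hn0 : (0 : ℝ) < n := by exact_mod_cast hn
  have hdev : ∀ m, 0 ≤ devWeight n m := fun m => by linarith [two_le_devWeight n m]
  obtain ⟨a, ha, hYa⟩ := exists_posteriorMean_eq (fun m => (hμ m).le) hK hn hl D hX
  set θ : ℕ+ → ℝ := fun m => μ m * ∑ i, a i * realFourier m (D i).1 with hθ
  set T := ∑ i, |a i| * √2
  have hT0 : 0 ≤ T := Finset.sum_nonneg fun i _ => by positivity
  have hT : ∀ m, |∑ i, a i * realFourier m (D i).1| ≤ T := fun m => by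
    refine (Finset.abs_sum_le_sum_abs _ _).trans (Finset.sum_le_sum fun i _ => ?_)
    rw [abs_mul]
    gcongr
    exact abs_realFourier_le _ _
  have hθr : RapidDecay θ := by
    refine rapidDecay_of_abs_le_exp (γ := 2 * γ) (B := c₂ * T) (by positivity) fun m => ?_
    rw [hθ, abs_mul, abs_of_pos (hμ m)]
    calc μ m * _ ≤ (c₂ * Real.exp (-2 * γ * m)) * T := by
          gcongr
          · exact (hμ m).le.trans (hμ₂ m)
          · exact hμ₂ m
          · exact hT m
      _ = _ := by rw [neg_mul]; ring
  set g : ℕ+ → ℝ := fun m => θ m - c m with hg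
  have hgr : RapidDecay g := hθr.sub hc
  have hμs : Summable μ := by
    have := (summable_pnat_pow_mul_exp (γ := 2 * γ) (by positivity) 0).mul_left c₂
    refine Summable.of_nonneg_of_le (fun m => (hμ m).le) (fun m => ?_) this
    simpa using hμ₂ m
  set M := ∑' m, μ m
  have hM : ∀ m, μ m ≤ M := fun m => hμs.le_tsum m fun i _ => (hμ i).le
  set N : ℕ+ → ℝ := fun m => 1 + l / μ m with hN
  have hlμ : ∀ m, 0 < l / μ m := fun m => div_pos hl (hμ m)
  have hN1 : ∀ m, 1 ≤ N m := fun m => by have := hlμ m; simp only [hN]; linarith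
  have hN0 : ∀ m, 0 < N m := fun m => zero_lt_one.trans_le (hN1 m)
  -- Finite energy: N_m ≤ (M + l)/μ_m, while θ_m = O(μ_m) for fixed data and ∑ c_m²/μ_m converges.
  have hgN : Summable fun m => g m ^ 2 * N m := by
    refine Summable.of_nonneg_of_le (fun m => by have := hN0 m; positivity) (fun m => ?_)
      ((hμs.mul_left (T ^ 2 * (2 * (M + l)))).add (hcμ.mul_left (2 * (M + l))))
    have hμm := hμ m
    have h1 : g m ^ 2 ≤ 2 * θ m ^ 2 + 2 * c m ^ 2 := by
      simp only [hg]; nlinarith [sq_nonneg (θ m + c m)]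
    have h2 : N m ≤ (M + l) / μ m := by
      rw [add_div]
      exact add_le_add ((one_le_div hμm).2 (hM m)) le_rfl
    have h3 : θ m ^ 2 ≤ μ m ^ 2 * T ^ 2 := by
      rw [hθ, mul_pow, ← sq_abs (∑ i, _)]
      have := hT m
      gcongr
    have hMl : 0 ≤ (M + l) / μ m := (hN0 m).le.trans h2
    calc g m ^ 2 * N m ≤ (2 * (μ m ^ 2 * T ^ 2) + 2 * c m ^ 2) * ((M + l) / μ m) := by
          refine mul_le_mul (h1.trans (by linarith)) h2 (hN0 m).le (by positivity)
      _ = _ := by field_simp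
  set G : Fin n → ℝ := fun i => fourierSeries g 0 (D i).1 with hG
  have hGs : ∀ i, HasSum (fun m => g m * realFourier m (D i).1) (G i) := fun i => by
    have := (hgr.summable 0 (D i).1).hasSum
    simp_rw [realFourier_eq_fourierDeriv]
    exact this
  set e : ℕ+ → ℝ := fun m => (∑ i, G i * realFourier m (D i).1) / n with he
  set z : ℕ+ → ℝ := fun m =>
    (∑ i, ((D i).2 - fourierSeries c 0 (D i).1) * realFourier m (D i).1) / n with hz
  set r : ℕ+ → ℝ := fun m => z m - l / μ m * c m with hr
  -- Since n l a_i is the residual at X_i, averaging it against ψ_m gives (l/μ_m) θ_m = z_m - e_m;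
  -- subtracting (l/μ_m) c_m gives the claim.
  have heq : ∀ m, (N m - 1) * g m + e m = r m := fun m => by
    have h1 : ∀ i, n * l * a i = (D i).2 - fourierSeries c 0 (D i).1 - G i := fun i => by
      have h2 := hYa i
      rw [ha (hX i)] at h2
      simp only [hG, hg]
      rw [hθr.fourierSeries_sub hc]
      linarith
    have h3 : z m - e m = l * ∑ i, a i * realFourier m (D i).1 := by
      simp only [hz, he]
      rw [← sub_div, ← Finset.sum_sub_distrib, div_eq_iff hn0.ne', Finset.mul_sum, Finset.sum_mul]
      refine Finset.sum_congr rfl fun i _ => ?_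
      rw [← sub_mul, ← h1 i]; ring
    have h4 : (N m - 1) * θ m = l * ∑ i, a i * realFourier m (D i).1 := by
      simp only [hN, hθ]
      have := (hμ m).ne'
      field_simp; ring
    simp only [hr, hg]
    rw [mul_sub, h4, ← h3]
    simp only [hN]; ring
  have heg : HasSum (fun m => e m * g m) ((∑ i, G i ^ 2) / n) := by
    have := (hasSum_sum (s := Finset.univ) fun i _ => (hGs i).mul_left (G i)).div_const (n : ℝ)
    simp only [sq]
    refine this.congr_fun fun m => ?_
    simp only [he]
    rw [div_mul_eq_mul_div, Finset.sum_mul]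
    congr 1
    exact Finset.sum_congr rfl fun i _ => by ring
  have hdiff : ∀ m, HasSum (fun j => g j * ((∑ i, (realFourier m (D i).1 * realFourier j (D i).1 -
      if m = j then 1 else 0)) / n)) (e m - g m) := fun m => by
    have h1 := (hasSum_sum (s := Finset.univ) fun i _ =>
      (hGs i).mul_right (realFourier m (D i).1)).div_const (n : ℝ)
    have h2 : HasSum (fun j => if m = j then g j else 0) (g m) := by
      have := hasSum_single (f := fun j => if m = j then g j else 0) m fun j hj => by
        rw [if_neg hj.symm]
      simpa using this
    refine (h1.sub h2).congr_fun fun j => ?_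
    rw [Finset.sum_sub_distrib, sub_div, mul_sub]
    congr 1
    · rw [← mul_div_assoc, Finset.mul_sum]
      congr 1
      exact Finset.sum_congr rfl fun i _ => by ring
    · split_ifs <;> simp [hn0.ne']
  have hW' : Summable fun m => √(devWeight n m) ^ 2 / N m := by
    simpa only [Real.sq_sqrt (hdev _)] using hW
  have hvg : Summable fun m => √(devWeight n m) * |g m| := by
    have := (summable_mul_and_tsum_sq_le hN0 hW' hgN).1
    simpa only [abs_mul, abs_of_nonneg (Real.sqrt_nonneg _)] using this
  -- The Gram bound is a product in its two indices, so the deviation is dominated by a rank-one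
  -- form with vector √d, as `coercive_of_close` requires.
  have hclose : ∀ m, |e m - g m| ≤
      √(8 * n) / n * √(devWeight n m) * ∑' j, √(devWeight n j) * |g j| := fun m => by
    rw [← (hdiff m).tsum_eq, ← Real.norm_eq_abs]
    refine tsum_of_norm_bounded (hvg.hasSum.mul_left _) fun j => ?_
    rw [Real.norm_eq_abs, abs_mul, abs_div, abs_of_pos hn0]
    calc _ ≤ |g j| * (√(8 * n * (devWeight n m * devWeight n j)) / n) := by
          gcongr; exact hΔ m j
      _ = _ := by
          rw [Real.sqrt_mul (by positivity), Real.sqrt_mul (hdev m)]; ring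
  have hcoer' : q * ∑' m, g m ^ 2 * N m ≤ ∑' m, ((N m - 1) * g m ^ 2 + e m * g m) := by
    rcases hcoer with h | h
    · refine coercive_of_nonneg (fun m => ?_) hN1 hgN heg.summable ?_
      · have := h m
        simp only [hN]; linarith
      · rw [heg.tsum_eq]
        exact div_nonneg (Finset.sum_nonneg fun i _ => sq_nonneg _) hn0.le
    · refine le_trans ?_ (coercive_of_close hN1 (fun m => Real.sqrt_nonneg (devWeight n m))
        (by positivity) hgN hW' heg.summable hclose)
      simp only [Real.sq_sqrt (hdev _)]
      exact mul_le_mul_of_nonneg_right h (tsum_nonneg fun m => by have := hN0 m; positivity)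
  have hrN : ∀ m, r m ^ 2 / N m ≤
      8 * σ ^ 2 / n * (devWeight n m / N m) + 2 * l * (c m ^ 2 / μ m) := fun m => by
    have hμm := hμ m
    have hNm := hN0 m
    have h1 : r m ^ 2 ≤ 2 * z m ^ 2 + 2 * (l / μ m * c m) ^ 2 := by
      simp only [hr]; nlinarith [sq_nonneg (z m + l / μ m * c m)]
    have h2 : z m ^ 2 ≤ 4 * σ ^ 2 / n * devWeight n m := by
      simp only [hz]
      rw [div_pow, ← sq_abs, div_le_iff₀ (by positivity)]
      have := hdev m
      calc _ ≤ √(4 * n * σ ^ 2 * devWeight n m) ^ 2 := by gcongr; exact hZ m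
        _ = _ := by rw [Real.sq_sqrt (by positivity)]; field_simp
    -- Dividing by N_m ≥ l/μ_m cancels one of the two factors l/μ_m in the squared bias.
    have h3 : (l / μ m * c m) ^ 2 / N m ≤ l * (c m ^ 2 / μ m) := by
      rw [div_le_iff₀ hNm]
      have h4 : l / μ m ≤ N m := by simp only [hN]; linarith
      calc _ = l * (c m ^ 2 / μ m) * (l / μ m) := by field_simp
        _ ≤ _ := by gcongr
    calc _ ≤ (2 * (4 * σ ^ 2 / n * devWeight n m) + 2 * (l / μ m * c m) ^ 2) / N m := by
          gcongr; linarith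
      _ = 8 * σ ^ 2 / n * (devWeight n m / N m) + 2 * ((l / μ m * c m) ^ 2 / N m) := by ring
      _ ≤ _ := by linarith
  have hsR := (hW.mul_left (8 * σ ^ 2 / n)).add (hcμ.mul_left (2 * l))
  have hrs : Summable fun m => r m ^ 2 / N m :=
    Summable.of_nonneg_of_le (fun m => by have := hN0 m; positivity) hrN hsR
  refine ⟨θ, hθr, ha, hgN, (energy_bound hN1 heq hgN hrs hq hcoer').trans ?_⟩
  refine (Summable.tsum_le_tsum hrN hrs hsR).trans_eq ?_
  rw [(hW.mul_left (8 * σ ^ 2 / n)).tsum_add (hcμ.mul_left (2 * l)), tsum_mul_left, tsum_mul_left]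

/-! ### Uniform constants and the rate for derivatives -/

lemma eLpNorm_two_le {f : ℝ → ℝ} (hf : Continuous f) {B : ℝ} (hB : 0 ≤ B)
    (h : ∫ x, f x ^ 2 ∂uniform01 ≤ B ^ 2) : eLpNorm f 2 uniform01 ≤ ENNReal.ofReal B := by
  have hm : MemLp f 2 uniform01 := by
    obtain ⟨b, hb⟩ := isCompact_Icc.exists_bound_of_continuousOn (hf.continuousOn (s := Icc 0 1))
    refine MemLp.of_bound hf.aestronglyMeasurable b ?_
    filter_upwards [ae_uniform01_mem] with x hx using hb x hx
  rw [hm.eLpNorm_eq_integral_rpow_norm two_ne_zero ENNReal.ofNat_ne_top]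
  refine ENNReal.ofReal_le_ofReal ?_
  simp only [ENNReal.toReal_ofNat, Real.rpow_ofNat, Real.norm_eq_abs, sq_abs]
  rw [← one_div, ← Real.sqrt_eq_rpow]
  exact (Real.sqrt_le_sqrt h).trans_eq (Real.sqrt_sq hB)

lemma half_le_log {n : ℕ} (hn : 2 ≤ n) : 1 / 2 ≤ Real.log n := by
  have h : Real.log 2 ≤ Real.log n := Real.log_le_log two_pos (by exact_mod_cast hn)
  linarith [Real.log_two_gt_d9]

/-- These bounds are all that is used of either regime: the lower one controls the effective
dimension, the upper one keeps the bias at the order log² n / n of the variance. Powers of log n are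
exchanged using log n ≥ 1/2. -/
lemma exists_regularization_bounds {lam : ℕ → ℝ}
    (hlam : Comparable (Ici 2) lam (fun n => 1 / (n : ℝ)) ∨
      Comparable (Ici 2) lam (fun n => Real.log n / (n : ℝ))) :
    ∃ b B : ℝ, 0 < b ∧ 0 < B ∧ ∀ n : ℕ, 2 ≤ n →
      b / n ≤ lam n ∧ lam n ≤ B * Real.log n ^ 2 / n := by
  rcases hlam with ⟨c, C, hc, hC, h⟩ | ⟨c, C, hc, hC, h⟩
  · refine ⟨c, C * 4, hc, by positivity, fun n hn => ?_⟩
    obtain ⟨h1, h2⟩ := h n hn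
    have hL := half_le_log hn
    refine ⟨by rwa [mul_one_div] at h1, h2.trans ?_⟩
    rw [mul_one_div]
    have h4 : 1 ≤ 4 * Real.log n ^ 2 := by nlinarith
    gcongr
    nlinarith
  · refine ⟨c / 2, C * 2, by positivity, by positivity, fun n hn => ?_⟩
    obtain ⟨h1, h2⟩ := h n hn
    have hL := half_le_log hn
    rw [← mul_div_assoc] at h1 h2
    have h3 : c / 2 ≤ c * Real.log n := by nlinarith
    have h4 : Real.log n ≤ 2 * Real.log n ^ 2 := by nlinarith
    have h5 : C * Real.log n ≤ C * 2 * Real.log n ^ 2 := by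
      rw [mul_assoc]
      gcongr
    exact ⟨le_trans (by gcongr) h1, h2.trans (by gcongr)⟩

/-- A uniform coercivity constant: the Gram matrix is close to the identity for large `n`, and for
small `n` the regularization alone suffices. -/
lemma exists_coercivity_constant {C b M : ℝ} (hb : 0 < b) (hM : 0 < M) :
    ∃ q : ℝ, 0 < q ∧ ∀ n : ℕ, 2 ≤ n → ∀ l : ℝ, b / n ≤ l →
      ∀ μ : ℕ+ → ℝ, (∀ m, 0 < μ m) → (∀ m, μ m ≤ M) → ∀ W : ℝ, 0 ≤ W → W ≤ C * Real.log n ^ 2 →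
        (∀ m, q * (1 + l / μ m) ≤ l / μ m) ∨ q ≤ 1 - √(8 * n) / n * W := by
  -- With W ≤ C log² n this threshold gives 32W² ≤ n, which is √(8n)/n · W ≤ 1/2.
  have hlim : ∀ᶠ n : ℕ in Filter.atTop, 32 * C ^ 2 * Real.log n ^ 4 ≤ n := by
    have h := (Real.isLittleO_pow_log_id_atTop (n := 4)).comp_tendsto
      (tendsto_natCast_atTop_atTop (R := ℝ))
    have h2 := h.bound (show 0 < 1 / (32 * C ^ 2 + 1) by positivity)
    filter_upwards [h2] with n hn
    simp only [Function.comp, id, Real.norm_eq_abs, Nat.abs_cast] at hn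
    have h3 := (le_abs_self _).trans hn
    rw [div_mul_eq_mul_div, one_mul, le_div_iff₀ (by positivity)] at h3
    have : 0 ≤ Real.log n ^ 4 := by positivity
    nlinarith
  obtain ⟨n₀, hn₀⟩ := Filter.eventually_atTop.1 hlim
  -- A lower bound for `l` over all n ≤ n₀. There l/(l + μ_m) ≥ β/(β + M), the second candidate for
  -- q.
  set β := b / (n₀ + 1 : ℝ) with hβ
  have hβ0 : 0 < β := by positivity
  refine ⟨min (1 / 2) (β / (β + M)), by positivity, fun n hn l hl μ hμ hμM W hW0 hW => ?_⟩
  have hn0 : (0 : ℝ) < n := by positivity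
  rcases le_total n₀ n with h | h
  · right
    have h1 := hn₀ n h
    have h2 : √(8 * n) / n * W ≤ 1 / 2 := by
      refine abs_le_of_sq_le_sq' ?_ (by norm_num) |>.2
      rw [mul_pow, div_pow, Real.sq_sqrt (by positivity)]
      have h3 : W ^ 2 ≤ C ^ 2 * Real.log n ^ 4 := by
        calc W ^ 2 ≤ (C * Real.log n ^ 2) ^ 2 := by gcongr
          _ = _ := by ring
      calc 8 * (n : ℝ) / n ^ 2 * W ^ 2 = 8 * W ^ 2 / n := by field_simp
        _ ≤ (1 / 2) ^ 2 := by rw [div_le_iff₀ hn0]; linarith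
    linarith [min_le_left (1 / 2) (β / (β + M))]
  · left
    intro m
    have hμm := hμ m
    have hβl : β ≤ l := by
      refine le_trans ?_ hl
      rw [hβ]
      have : (n : ℝ) ≤ n₀ := by exact_mod_cast h
      gcongr
      linarith
    have hl0 : 0 < l := hβ0.trans_le hβl
    have h1 : β / (β + M) ≤ l / (l + μ m) := by
      rw [div_le_div_iff₀ (by positivity) (by positivity)]
      nlinarith [hμM m, mul_le_mul hβl (hμM m) hμm.le hl0.le]
    calc _ ≤ l / (l + μ m) * (1 + l / μ m) := by
          gcongr
          exact (min_le_right _ _).trans h1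
      _ = l / μ m := by field_simp; ring

/-- On the good event the posterior mean is smooth and its derivatives are close to those of the
regression function. -/
lemma posteriorMean_error_le {K : ℝ → ℝ → ℝ} {c : ℕ+ → ℝ} {γ γ₀ B₀ σ : ℝ} (hγ : 0 < γ)
    (hγ₀ : γ < γ₀) (hK : IsExpKernel γ K) (hc : ∀ i : ℕ+, |c i| ≤ B₀ * Real.exp (-γ₀ * i))
    {lam : ℕ → ℝ} (hlam : Comparable (Ici 2) lam (fun n => 1 / (n : ℝ)) ∨
      Comparable (Ici 2) lam (fun n => Real.log n / (n : ℝ))) (k : ℕ) :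
    ∃ C : ℝ, 0 < C ∧ ∀ n : ℕ, 2 ≤ n → ∀ D ∈ goodEvent (fourierSeries c 0) σ n,
      ∃ θ : ℕ+ → ℝ, RapidDecay θ ∧
        EqOn (posteriorMean K (lam n) D) (fourierSeries θ 0) (Icc 0 1) ∧
        ∫ x, fourierSeries (fun m => θ m - c m) k x ^ 2 ∂uniform01 ≤
          (C * (Real.log n ^ (k + 1) / √(n : ℝ))) ^ 2 := by
  obtain ⟨μ, ⟨c₁, c₂, hc₁, hc₂, hμb⟩, hKs⟩ := hK
  have hμ₁ : ∀ m : ℕ+, c₁ * Real.exp (-2 * γ * m) ≤ μ m := fun m => (hμb m (mem_univ m)).1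
  have hμ₂ : ∀ m : ℕ+, μ m ≤ c₂ * Real.exp (-2 * γ * m) := fun m => (hμb m (mem_univ m)).2
  have hμ : ∀ m, 0 < μ m := fun m => (by positivity : 0 < c₁ * _).trans_le (hμ₁ m)
  have hμM : ∀ m, μ m ≤ c₂ := fun m => (hμ₂ m).trans <|
    mul_le_of_le_one_right hc₂.le <| Real.exp_le_one_iff.2 <| by
      have : 0 < γ * m := mul_pos hγ (by exact_mod_cast m.pos)
      linarith
  have hcr : RapidDecay c := rapidDecay_of_abs_le_exp (hγ.trans hγ₀) hc
  -- This says that f₀ lies in the reproducing kernel Hilbert space of K; the terms are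
  -- O(e^{-2(γ₀-γ)m}).
  have hcμ : Summable fun m => c m ^ 2 / μ m := by
    have h := (summable_pnat_pow_mul_exp (γ := 2 * (γ₀ - γ)) (by linarith) 0).mul_left
      (B₀ ^ 2 / c₁)
    refine Summable.of_nonneg_of_le (fun m => by have := hμ m; positivity) (fun m => ?_) h
    calc c m ^ 2 / μ m ≤ (B₀ * Real.exp (-γ₀ * m)) ^ 2 / (c₁ * Real.exp (-2 * γ * m)) := by
          rw [← sq_abs]
          have := hc m
          have := hμ₁ m
          gcongr
      _ = B₀ ^ 2 / c₁ * (Real.exp (-γ₀ * m) ^ 2 / Real.exp (-2 * γ * m)) := by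
          rw [mul_pow]; field_simp
      _ = _ := by
          rw [← Real.exp_nat_mul, ← Real.exp_sub, pow_zero, one_mul]
          congr 2; push_cast; ring
  obtain ⟨b, B, hb, hB, hlb⟩ := exists_regularization_bounds hlam
  have hA : 0 ≤ c₂ / b := by positivity
  obtain ⟨CW, hCW, hW⟩ := summable_mul_weight hγ hA
  obtain ⟨Ck, hCk, hk⟩ := pow_mul_weight_le hγ hA (2 * k)
  obtain ⟨q, hq, hcoer⟩ := exists_coercivity_constant (C := CW) hb hc₂
  set R := ∑' m, c m ^ 2 / μ m
  have hR : 0 ≤ R := tsum_nonneg fun m => by have := hμ m; positivity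
  -- The added 1 only makes the constant positive.
  set CS := (8 * σ ^ 2 * CW + 2 * B * R) / q ^ 2 + 1 with hCS
  have hCS0 : 0 < CS := by positivity
  have hpi := Real.pi_pos
  refine ⟨√(Real.pi ^ (2 * k) * Ck * CS), by positivity, fun n hn D hD => ?_⟩
  have hn0 : (0 : ℝ) < n := by positivity
  obtain ⟨hl1, hl2⟩ := hlb n hn
  have hl : 0 < lam n := (by positivity : 0 < b / n).trans_le hl1
  set L := Real.log n with hL
  have hL2 : Real.log 2 ≤ L := Real.log_le_log two_pos (by exact_mod_cast hn)
  set w : ℕ+ → ℝ := fun m => 1 / (1 + lam n / μ m) with hw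
  have hN1 : ∀ m, 1 ≤ 1 + lam n / μ m := fun m => by
    have := div_pos hl (hμ m); linarith
  have hw0 : ∀ m, 0 ≤ w m := fun m => by
    have := hN1 m
    simp only [hw]; positivity
  have hw1 : ∀ m, w m ≤ 1 := fun m => by
    have := hN1 m
    simp only [hw]; rwa [div_le_one (by linarith)]
  have hwA : ∀ m : ℕ+, w m ≤ c₂ / b * Real.exp (L - 2 * γ * m) := fun m => by
    have hμm := hμ m
    calc w m ≤ 1 / (lam n / μ m) := by
          simp only [hw]
          gcongr
          linarith
      _ = μ m / lam n := one_div_div _ _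
      _ ≤ (c₂ * Real.exp (-2 * γ * m)) / (b / n) := by
          have := hμ₂ m
          gcongr
      _ = _ := by
          rw [hL, sub_eq_add_neg, Real.exp_add, Real.exp_log hn0]
          simp only [neg_mul]
          field_simp
  obtain ⟨hWs, hWle⟩ := hW L w hL2 hw0 hw1 hwA
  have hdw : ∀ m, (12 * L + 2 * m) * w m = devWeight n m / (1 + lam n / μ m) := fun m => by
    simp only [hw, devWeight, mul_one_div, hL]
  simp_rw [hdw] at hWs hWle
  have hW0 : 0 ≤ ∑' m, devWeight n m / (1 + lam n / μ m) := tsum_nonneg fun m =>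
    div_nonneg (by linarith [two_le_devWeight n m]) (by linarith [hN1 m])
  obtain ⟨θ, hθ, hEq, hS, hSle⟩ := energy_le_of_mem_goodEvent hγ hμ hμ₂ hKs hcr hcμ (by omega) hl
    hD hq.le hWs (hcoer n hn _ hl1 μ hμ hμM _ hW0 hWle)
  refine ⟨θ, hθ, hEq, ?_⟩
  set S := ∑' m, (θ m - c m) ^ 2 * (1 + lam n / μ m)
  have hSb : S ≤ CS * L ^ 2 / n := by
    have h1 : q ^ 2 * S ≤ (8 * σ ^ 2 * CW + 2 * B * R) * L ^ 2 / n := by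
      calc q ^ 2 * S ≤ _ := hSle
        _ ≤ 8 * σ ^ 2 / n * (CW * L ^ 2) + 2 * (B * L ^ 2 / n) * R := by gcongr
        _ = _ := by ring
    calc S = q ^ 2 * S / q ^ 2 := by field_simp
      _ ≤ (8 * σ ^ 2 * CW + 2 * B * R) * L ^ 2 / n / q ^ 2 := by gcongr
      _ = (8 * σ ^ 2 * CW + 2 * B * R) / q ^ 2 * L ^ 2 / n := by ring
      _ ≤ _ := by gcongr; rw [hCS]; linarith
  have hsq := (hθ.sub hcr).hasSum_sq k
  -- Frequencies are traded for energy: ω_m^{2k} ≤ (πm)^{2k}, and m^{2k}/N_m ≤ Ck L^{2k}.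
  have hterm : ∀ m, (θ m - c m) ^ 2 * fourierFreq m ^ (2 * k) ≤
      Real.pi ^ (2 * k) * Ck * L ^ (2 * k) * ((θ m - c m) ^ 2 * (1 + lam n / μ m)) := fun m => by
    have hNm : 0 < 1 + lam n / μ m := by linarith [hN1 m]
    have h1 := hk L (w m) m hL2 (hw1 m) (hwA m)
    simp only [hw] at h1
    rw [mul_one_div, div_le_iff₀ hNm] at h1
    have h2 : fourierFreq m ^ (2 * k) ≤ Real.pi ^ (2 * k) * (m : ℝ) ^ (2 * k) := by
      rw [← mul_pow]
      exact pow_le_pow_left₀ (fourierFreq_nonneg m) (fourierFreq_le m) _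
    calc _ ≤ (θ m - c m) ^ 2 *
          (Real.pi ^ (2 * k) * (Ck * L ^ (2 * k) * (1 + lam n / μ m))) := by
          gcongr
          exact h2.trans (by gcongr)
      _ = _ := by ring
  calc _ = ∑' m, (θ m - c m) ^ 2 * fourierFreq m ^ (2 * k) := hsq.tsum_eq.symm
    _ ≤ ∑' m, Real.pi ^ (2 * k) * Ck * L ^ (2 * k) * ((θ m - c m) ^ 2 * (1 + lam n / μ m)) :=
        Summable.tsum_le_tsum hterm hsq.summable (hS.mul_left _)
    _ = Real.pi ^ (2 * k) * Ck * L ^ (2 * k) * S := tsum_mul_left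
    _ ≤ Real.pi ^ (2 * k) * Ck * L ^ (2 * k) * (CS * L ^ 2 / n) := by
        have : 0 ≤ L ^ (2 * k) := by rw [pow_mul']; positivity
        gcongr
    _ = _ := by
        rw [mul_pow, div_pow, Real.sq_sqrt (by positivity), Real.sq_sqrt hn0.le]
        ring

end

theorem lemma4 (γ₀ γ σ : ℝ) (hγ : 1 / 2 < γ) (hγ₀ : γ < γ₀) (hσ : 0 < σ)
    (f₀ : ℝ → ℝ) (hf₀c : ContinuousOn f₀ (Icc (0 : ℝ) 1)) (hf₀ : AnalyticClass γ₀ f₀)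
    (K : ℝ → ℝ → ℝ) (hK : IsExpKernel γ K)
    (lam : ℕ → ℝ)
    (hlam : Comparable (Ici 2) lam (fun n => 1 / (n : ℝ)) ∨
      Comparable (Ici 2) lam (fun n => Real.log n / (n : ℝ)))
    (k : ℕ) :
    ContDiffOn ℝ k f₀ (Icc (0 : ℝ) 1) ∧
    ∃ C : ℝ, 0 < C ∧ ∀ n : ℕ, 1 ≤ n →
      1 - 1 / (n : ℝ) ^ 10 ≤
        (sampleLaw f₀ σ n).real
          {D | ContDiffOn ℝ k (posteriorMean K (lam n) D) (Icc (0 : ℝ) 1) ∧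
            eLpNorm (fun x => deriv01 k (posteriorMean K (lam n) D) x - deriv01 k f₀ x)
                2 uniform01
              ≤ ENNReal.ofReal (C * (Real.log n ^ (k + 1) / √(n : ℝ)))} := by
  have hγ0 : 0 < γ := by linarith
  obtain ⟨B₀, hB₀⟩ := hf₀.exists_abs_coef_le
  set c := realFourierCoef f₀ with hc
  have hcr : RapidDecay c := rapidDecay_of_abs_le_exp (hγ0.trans hγ₀) hB₀
  have hfF : EqOn f₀ (fourierSeries c 0) (Icc 0 1) := eqOn_fourierSeries hf₀c hf₀.1 hcr
  refine ⟨hcr.contDiffOn hfF k, ?_⟩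
  obtain ⟨C, hC, hmain⟩ := posteriorMean_error_le (σ := σ) hγ0 hγ₀ hK hB₀ hlam k
  refine ⟨C, hC, fun n hn => ?_⟩
  -- For n = 1 the required probability is 1 - 1 = 0.
  rcases hn.eq_or_lt with rfl | hn2
  · simp
  have hFm : Measurable (fourierSeries c 0) := (hcr.continuous 0).measurable
  have := isProbabilityMeasure_observationLaw hFm σ
  rw [sampleLaw, observationLaw_congr hfF, ← sampleLaw]
  have hP : IsProbabilityMeasure (sampleLaw (fourierSeries c 0) σ n) := by
    rw [sampleLaw]; infer_instance
  set P := sampleLaw (fourierSeries c 0) σ n with hPdef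
  have hgood : goodEvent (fourierSeries c 0) σ n ⊆
      {D | ContDiffOn ℝ k (posteriorMean K (lam n) D) (Icc (0 : ℝ) 1) ∧
            eLpNorm (fun x => deriv01 k (posteriorMean K (lam n) D) x - deriv01 k f₀ x)
                2 uniform01
              ≤ ENNReal.ofReal (C * (Real.log n ^ (k + 1) / √(n : ℝ)))} := fun D hD => by
    obtain ⟨θ, hθ, hEq, hint⟩ := hmain n hn2 D hD
    refine ⟨hθ.contDiffOn hEq k, ?_⟩
    have hae : (fun x => deriv01 k (posteriorMean K (lam n) D) x - deriv01 k f₀ x)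
        =ᵐ[uniform01] fourierSeries (fun m => θ m - c m) k := by
      filter_upwards [ae_uniform01_mem] with x hx
      rw [hθ.deriv01_eq hEq k hx, hcr.deriv01_eq hfF k hx, hθ.fourierSeries_sub hcr]
    rw [eLpNorm_congr_ae hae]
    have : 0 ≤ Real.log n := Real.log_natCast_nonneg n
    exact eLpNorm_two_le ((hθ.sub hcr).continuous k) (by positivity) hint
  have hcompl : P.real (goodEvent (fourierSeries c 0) σ n)ᶜ ≤ 1 / (n : ℝ) ^ 10 :=
    ENNReal.toReal_le_of_le_ofReal (by positivity) (measure_compl_goodEvent_le hFm hσ hn2)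
  -- Subadditivity suffices here, so neither the good event nor the target event needs to be shown
  -- measurable.
  have hone : (1 : ℝ) ≤ P.real (goodEvent (fourierSeries c 0) σ n) +
      P.real (goodEvent (fourierSeries c 0) σ n)ᶜ := by
    have := measureReal_union_le (μ := P) (goodEvent (fourierSeries c 0) σ n)
      (goodEvent (fourierSeries c 0) σ n)ᶜ
    rwa [union_compl_self, probReal_univ] at this
  have := measureReal_mono (μ := P) hgood
  linarith
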